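/- For $S\in\mathbb{R}^{k\times n}$ and $A\in\mathbb{R}^{n\times d}$ let $\mathrm{cost}_k(S,A)=\min\{\|X-A\|_F^2 : \mathrm{rank}(X)\le k,\ \text{the rows of } X \text{ lie in } \mathrm{row}(SA)\}$. For positions $p:[n]\to[k]$ and signs $\sigma\in\{\pm1\}^n$ let $\mathrm{CS}(p,\sigma)\in\mathbb{R}^{k\times n}$ be the CountSketch whose $i$-th column has the single nonzero entry $\sigma_i$, in row $p(i)$. The greedy algorithm on training matrices $A^{(t)}$, $t\in T$ (which have the same row norms), starts with $S=0$, goes through the columns $i$ in an order of non-increasing norms of the rows $A^{(t)}_i$, picks $p(i)\in\arg\min_{j\in[k]}\sum_{t\in T}\mathrm{cost}_k(S+\sigma_i e_je_i^\top,A^{(t)})$ (ties broken arbitrarily), and replaces $S$ by $S+\sigma_i e_{p(i)}e_i^\top$; it outputs $p$. Say that *greedy beats random by $\eta$* on matrices $A^{(1)},\dots,A^{(N)}\in\mathbb{R}^{n\times d}$ if for every non-empty $T\subseteq[N]$, all signs $\sigma$, every output $p$ of the greedy algorithm on $(A^{(t)})_{t\in T}$ (for any admissible order and any tie-breaking), every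 $t\in[N]$, and all signs $\tau,\tau'\in\{\pm1\}^n$, $$\mathrm{cost}_k(\mathrm{CS}(p,\tau),A^{(t)})\le(1-\eta)\,\mathbb{E}_{q}\big[\mathrm{cost}_k(\mathrm{CS}(q,\tau'),A^{(t)})\big],$$ where $q:[n]\to[k]$ is uniformly random. (The case $T=\{t\}$ is training on the matrix itself.) **Theorem.** There is a fixed $\eta\in(0,1)$ such that both of the following hold. 1. (Spiked covariance model.) For every $c\in\mathbb{N}$ there is a constant $C>0$ such that the following holds for all $n,d,k,s,N\in\mathbb{N}$ and $\alpha,\ell\in\mathbb{R}$ with $s\ge1$, $s=\alpha(k-1)$, $0.7<\alpha<1$, $\ell>1$, $\ell^2\ge\frac{(4e+1)n}{\alpha k}$ and $d\ge C n^6\ell^2$, and for every $\mathcal{R}\subseteq[n]$ with $|\mathcal{R}|=s$. Let $A^{(1)},\dots,A^{(N)}\in\mathbb{R}^{n\times d}$ be independent random matrices, each with rows $A_i=\ell v_i$ for $i\in\mathcal{R}$ and $A_i=v_i$ for $i\notin\mathcal{R}$, where $v_1,\dots,v_n$ are independent uniformly random unit vectors in $\mathbb{R}^d$. Then with probability at least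 $1-N n^{-c}$, greedy beats random by $\eta$ on $A^{(1)},\dots,A^{(N)}$. 2. (Zipfian squared row norms.) There is $k_0$ such that for all $k\ge k_0$, all $n,d,h,N\in\mathbb{N}$ and every assignment of levels $\mathrm{lev}:[n]\to\{1,\dots,h\}$ with exactly $2^{i+1}$ rows at each level $i\in\{1,\dots,h\}$, the following holds: if $A^{(1)},\dots,A^{(N)}\in\mathbb{R}^{n\times d}$ are any matrices with pairwise orthogonal rows such that the row with index $r$ has squared norm $n^2/2^{2\,\mathrm{lev}(r)}$, then greedy beats random by $\eta$ on $A^{(1)},\dots,A^{(N)}$. In particular this holds surely when the rows are uniformly random orthogonal vectors of these norms. -/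

import Mathlib

open MeasureTheory

noncomputable section

/-- The loss `min ‖X - A‖_F²` over all `X` of rank at most `k` whose rows lie in the row space
of `S A`.  (The set is non-empty, as it contains `‖A‖_F²`, and is bounded below by `0`.) -/
def sketchCost {m n d : ℕ} (k : ℕ) (S : Matrix (Fin m) (Fin n) ℝ)
    (A : Matrix (Fin n) (Fin d) ℝ) : ℝ :=
  sInf {c : ℝ | ∃ X : Matrix (Fin n) (Fin d) ℝ, X.rank ≤ k ∧
    (∀ i, X i ∈ Submodule.span ℝ (Set.range (fun j => (S * A) j))) ∧
    c = ∑ i, ∑ j, (X i j - A i j) ^ 2}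

/-- The sketch with nonzero positions `p` and values `v`: column `i` has the single nonzero
entry `v i`, in row `p i`. -/
def countSketch {m n : ℕ} (p : Fin n → Fin m) (v : Fin n → ℝ) : Matrix (Fin m) (Fin n) ℝ :=
  Matrix.of fun j i => if p i = j then v i else 0

/-- All entries are `1` or `-1`. -/
def IsSign {n : ℕ} (σ : Fin n → ℝ) : Prop := ∀ i, σ i = 1 ∨ σ i = -1

/-- The sketch before step `a` of the greedy algorithm, when the columns are processed in the
order `π 0, π 1, …`: only the columns `π b` with `b < a` have been filled. -/
def partialSketch {m n : ℕ} (π : Equiv.Perm (Fin n)) (p : Fin n → Fin m) (σ : Fin n → ℝ)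
    (a : Fin n) : Matrix (Fin m) (Fin n) ℝ :=
  Matrix.of fun j i => if π.symm i < a ∧ p i = j then σ i else 0

/-- `p` is an output of the greedy position search for a sketch with `k` rows on the training
matrices `A t`, `t ∈ T`: the columns are processed in an order `π` in which the row norms do not
increase, and each new entry (with its sign, given by `σ`) is put at a position that minimizes the
total loss over the training matrices of the sketch built so far.  Ties are broken arbitrarily.
Since the sign `σ i` is arbitrary, this covers signs fixed in advance, random signs, and signs that
are optimized together with the position. -/
def IsGreedyRun {n d N : ℕ} (k : ℕ) (T : Finset (Fin N))
    (A : Fin N → Matrix (Fin n) (Fin d) ℝ) (π : Equiv.Perm (Fin n)) (σ : Fin n → ℝ)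
    (p : Fin n → Fin k) : Prop :=
  (∀ t ∈ T, ∀ a b : Fin n, a ≤ b →
    ∑ j, (A t (π b) j) ^ 2 ≤ ∑ j, (A t (π a) j) ^ 2) ∧
  ∀ (a : Fin n) (j : Fin k),
    ∑ t ∈ T, sketchCost k
        (partialSketch π p σ a + Matrix.single (p (π a)) (π a) (σ (π a))) (A t) ≤
      ∑ t ∈ T, sketchCost k
        (partialSketch π p σ a + Matrix.single j (π a) (σ (π a))) (A t)

/-- The expected loss of a sketch with `k` rows and values `τ` whose positions are chosen
independently and uniformly at random. -/
def expectedRandomCost {n d : ℕ} (k : ℕ) (τ : Fin n → ℝ) (A : Matrix (Fin n) (Fin d) ℝ) : ℝ :=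
  (∑ p : Fin n → Fin k, sketchCost k (countSketch p τ) A) / (k : ℝ) ^ n

/-- Positions learned greedily on any non-empty part of the family `A` are better by the factor
`1 - η` than random positions, on every member of the family (and for all choices of signs). -/
def GreedyBeatsRandom {n d N : ℕ} (k : ℕ) (η : ℝ) (A : Fin N → Matrix (Fin n) (Fin d) ℝ) : Prop :=
  ∀ (T : Finset (Fin N)) (π : Equiv.Perm (Fin n)) (σ : Fin n → ℝ) (p : Fin n → Fin k),
    T.Nonempty → IsSign σ → IsGreedyRun k T A π σ p →
    ∀ (t : Fin N) (τ τ' : Fin n → ℝ), IsSign τ → IsSign τ' →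
      sketchCost k (countSketch p τ) (A t) ≤ (1 - η) * expectedRandomCost k τ' (A t)

/-- The uniform distribution on the unit sphere of `ℝ^d`. -/
def uniformSphere (d : ℕ) : Measure (Metric.sphere (0 : EuclideanSpace ℝ (Fin d)) 1) :=
  ((volume : Measure (EuclideanSpace ℝ (Fin d))).toSphere Set.univ)⁻¹ •
    (volume : Measure (EuclideanSpace ℝ (Fin d))).toSphere

theorem isProbabilityMeasure_uniformSphere (d : ℕ) (hd : 0 < d) :
    IsProbabilityMeasure (uniformSphere d) := by
  constructor
  have : NeZero d := ⟨hd.ne'⟩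
  have h0 : (volume : Measure (EuclideanSpace ℝ (Fin d))).toSphere Set.univ ≠ 0 := by
    rw [Measure.toSphere_apply_univ]
    refine mul_ne_zero ?_ (Metric.measure_ball_pos _ _ one_pos).ne'
    simpa using hd.ne'
  simp only [uniformSphere, Measure.smul_apply, smul_eq_mul]
  exact ENNReal.inv_mul_cancel h0 (measure_ne_top _ _)

/-- The matrix with rows `ℓ • v i` for `i ∈ R` and `v i` for `i ∉ R`. -/
def spikedMatrix {n d : ℕ} (R : Finset (Fin n)) (ℓ : ℝ)
    (v : Fin n → Metric.sphere (0 : EuclideanSpace ℝ (Fin d)) 1) : Matrix (Fin n) (Fin d) ℝ :=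
  Matrix.of fun i j => (if i ∈ R then ℓ else 1) * (v i : EuclideanSpace ℝ (Fin d)) j

/-- The law of the directions of the rows of `N` independent `n × d` samples of the spiked
covariance model: independent uniformly random unit vectors. -/
def spikedDirections (N n d : ℕ) :
    Measure (Fin N → Fin n → Metric.sphere (0 : EuclideanSpace ℝ (Fin d)) 1) :=
  Measure.pi fun _ => Measure.pi fun _ => uniformSphere d

/-- Row `i` is at level `lev i ∈ {1, …, h}`, and there are exactly `2^(m+1)` rows at level `m`. -/
def IsZipfLevels {n : ℕ} (h : ℕ) (lev : Fin n → ℕ) : Prop :=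
  (∀ i, 1 ≤ lev i ∧ lev i ≤ h) ∧
  ∀ m, 1 ≤ m → m ≤ h → (Finset.univ.filter fun i => lev i = m).card = 2 ^ (m + 1)

/-- A member of the Zipfian family with levels `lev`: the rows are pairwise orthogonal, and
row `i` has squared norm `n² / 2^(2 lev i)`. -/
def IsZipfMatrix {n d : ℕ} (lev : Fin n → ℕ) (A : Matrix (Fin n) (Fin d) ℝ) : Prop :=
  (∀ i i', i ≠ i' → ∑ j, A i j * A i' j = 0) ∧
  ∀ i, ∑ j, (A i j) ^ 2 = (n : ℝ) ^ 2 / 2 ^ (2 * lev i)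

end

noncomputable section

/-! Suppose the rows of `A` are orthogonal with squared norms `w`. Then the rows of `S A` are
orthogonal too. The one for bin `j` has squared norm `W j`, the sum of `w` over the bin, and
projecting row `i` onto it recovers `w i ^ 2 / W j`. The loss is therefore `∑ w - ∑ j, Q j / W j`,
where `Q j` sums `w ^ 2` over the bin. It depends on neither the signs nor the directions.
Near-orthogonality changes it by a factor `1 ± ε` (`sketchCost_bounds`), so training on any family
with the same norms is one greedy bin process on numbers (`isGreedySeq_of_isGreedyRun`).

A bin captures at most its largest weight, because `Q / W` is a weighted mean. Hence every collision
between large weights costs a random sketch a fixed amount (`le_diagCost`, `le_diagCost_of_le`).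
Among `h ≤ k + 1` elements the expected number of collisions is at least `h (h - 1) / (3 k)`
(`le_sum_card_sub_card_image`).

Spiked model: random directions in high dimension are nearly orthogonal (`uniformSphere_cap_le` and
a union bound). There are fewer heavy rows than bins, and greedy isolates each of them
(`IsGreedySeq.ne_of_heavy`), so its loss is at most about `n`. Random collisions cost about `ℓ ^ 2`
each, which sums to more than `n` by a constant factor.

Zipfian norms: let `θ` be the `k`-th largest weight. Greedy first fills all bins with single
elements. The rest of level `θ` joins bins of pure `θ` for free. The whole next level then sticks to
one such bin, which makes that bin heavy enough to absorb all later elements cheaply. Greedy thus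
loses at most `2 θ` compared with capturing the `k` largest weights
(`IsGreedySeq.sum_sub_le_captured`), while random positions lose an extra multiple of `k θ`. The
remaining loss is itself of order `k θ`, so this is a constant factor. -/

/-! ### The loss of a sketch on nearly orthogonal rows. -/

/-- The sum of `f` over the elements of `s` that `p` puts into the bin `j`. -/
def binSum {ι κ : Type*} [DecidableEq κ] (f : ι → ℝ) (s : Finset ι) (p : ι → κ) (j : κ) : ℝ :=
  ∑ i ∈ s with p i = j, f i

/-- The loss of a sketch with filled columns `s` and positions `p`, for a matrix whose rows are
pairwise orthogonal with squared norms `w`. -/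
def diagCost {n k : ℕ} (w : Fin n → ℝ) (s : Finset (Fin n)) (p : Fin n → Fin k) : ℝ :=
  ∑ i, w i - ∑ j, binSum (fun i => w i ^ 2) s p j / binSum w s p j

/-- The Gram matrix of the rows of `A` agrees with `diag w` up to the relative error `ε`. -/
def NearOrthogonal {n d : ℕ} (ε : ℝ) (w : Fin n → ℝ) (A : Matrix (Fin n) (Fin d) ℝ) : Prop :=
  ∀ z : Fin n → ℝ,
    |∑ j, (∑ i, z i * A i j) ^ 2 - ∑ i, z i ^ 2 * w i| ≤ ε * ∑ i, z i ^ 2 * w i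

/-- Regrouping by rows matches the minimization over `X`, which decouples row by row. -/
theorem diagCost_eq_sum {n k : ℕ} (w : Fin n → ℝ) (s : Finset (Fin n)) (p : Fin n → Fin k) :
    diagCost w s p = ∑ i, (w i - if i ∈ s then w i ^ 2 / binSum w s p (p i) else 0) := by
  rw [diagCost, Finset.sum_sub_distrib]
  congr 1
  rw [← Finset.sum_filter, Finset.filter_mem_eq_inter, Finset.univ_inter,
    ← Finset.sum_fiberwise s p]
  refine Finset.sum_congr rfl fun j _ => ?_
  rw [binSum, Finset.sum_div]
  refine Finset.sum_congr rfl fun i hi => ?_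
  rw [(Finset.mem_filter.1 hi).2]

theorem countSketch_mul_apply {m n d : ℕ} (p : Fin n → Fin m) (v : Fin n → ℝ)
    (A : Matrix (Fin n) (Fin d) ℝ) (l : Fin m) (j : Fin d) :
    (countSketch p v * A) l j = ∑ i, (if p i = l then v i else 0) * A i j := by
  simp [Matrix.mul_apply, countSketch]

theorem sum_mul_countSketch_mul {m n d : ℕ} (p : Fin n → Fin m) (v : Fin n → ℝ)
    (A : Matrix (Fin n) (Fin d) ℝ) (y : Fin m → ℝ) (j : Fin d) :
    ∑ l, y l * (countSketch p v * A) l j = ∑ i, (y (p i) * v i) * A i j := by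
  simp_rw [countSketch_mul_apply, Finset.mul_sum]
  rw [Finset.sum_comm]
  refine Finset.sum_congr rfl fun i _ => ?_
  rw [Finset.sum_eq_single (p i)]
  · simp; ring
  · intro b _ hb
    simp [hb.symm]
  · simp

theorem sum_mul_countSketch_mul_sub {m n d : ℕ} (p : Fin n → Fin m) (v : Fin n → ℝ)
    (A : Matrix (Fin n) (Fin d) ℝ) (y : Fin m → ℝ) (i : Fin n) (j : Fin d) :
    ∑ l, y l * (countSketch p v * A) l j - A i j =
      ∑ l, (y (p l) * v l - if l = i then 1 else 0) * A l j := by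
  rw [sum_mul_countSketch_mul]
  simp [sub_mul, Finset.sum_sub_distrib]

/-- The weighted square distance of the coefficient vectors of `∑ l, y l * (S A)_l` and `A_i`. -/
theorem sum_coeff_sq {n k : ℕ} (w : Fin n → ℝ) (s : Finset (Fin n)) (p : Fin n → Fin k)
    (v : Fin n → ℝ) (hs : ∀ i ∈ s, v i ^ 2 = 1) (hs' : ∀ i ∉ s, v i = 0) (y : Fin k → ℝ)
    (i : Fin n) :
    ∑ l, (y (p l) * v l - if l = i then 1 else 0) ^ 2 * w l =
      ∑ j, y j ^ 2 * binSum w s p j - 2 * y (p i) * v i * w i + w i := by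
  have h1 : ∀ l, (y (p l) * v l - if l = i then 1 else 0) ^ 2 * w l =
      y (p l) ^ 2 * (if l ∈ s then w l else 0) +
        if l = i then - 2 * y (p l) * v l * w l + w l else 0 := by
    intro l
    by_cases hl : l ∈ s
    · have := hs l hl
      split_ifs
      · linear_combination (y (p l)) ^ 2 * w l * this
      · linear_combination (y (p l)) ^ 2 * w l * this
    · rw [hs' l hl]
      split_ifs <;> simp
  simp_rw [h1]
  rw [Finset.sum_add_distrib, Finset.sum_ite_eq' Finset.univ i, if_pos (Finset.mem_univ _)]
  have h2 : ∑ l, y (p l) ^ 2 * (if l ∈ s then w l else 0) = ∑ j, y j ^ 2 * binSum w s p j := by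
    simp_rw [mul_ite, mul_zero]
    rw [← Finset.sum_filter, Finset.filter_mem_eq_inter, Finset.univ_inter,
      ← Finset.sum_fiberwise s p]
    refine Finset.sum_congr rfl fun j _ => ?_
    rw [binSum, Finset.mul_sum]
    refine Finset.sum_congr rfl fun l hl => ?_
    rw [(Finset.mem_filter.1 hl).2]
  rw [h2]; ring

theorem binSum_nonneg {ι κ : Type*} [DecidableEq κ] {f : ι → ℝ} {s : Finset ι}
    (hf : ∀ i ∈ s, 0 ≤ f i) (p : ι → κ) (j : κ) : 0 ≤ binSum f s p j :=
  Finset.sum_nonneg fun i hi => hf i (Finset.mem_filter.1 hi).1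

theorem le_binSum {ι κ : Type*} [DecidableEq κ] {f : ι → ℝ} {s : Finset ι}
    (hf : ∀ i ∈ s, 0 ≤ f i) (p : ι → κ) {i : ι} (hi : i ∈ s) : f i ≤ binSum f s p (p i) :=
  Finset.single_le_sum (f := f) (fun l hl => hf l (Finset.mem_filter.1 hl).1)
    (Finset.mem_filter.2 ⟨hi, rfl⟩)

/-- The loss of a sketch with one nonzero entry per filled column, up to the deviation of the
rows from orthogonality. -/
theorem sketchCost_bounds {n d k : ℕ} {ε : ℝ} (hε : ε ≤ 1) {w : Fin n → ℝ} (hw : ∀ i, 0 < w i)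
    {A : Matrix (Fin n) (Fin d) ℝ} (hA : NearOrthogonal ε w A) (s : Finset (Fin n))
    (p : Fin n → Fin k) (v : Fin n → ℝ) (hs : ∀ i ∈ s, v i ^ 2 = 1) (hs' : ∀ i ∉ s, v i = 0) :
    (1 - ε) * diagCost w s p ≤ sketchCost k (countSketch p v) A ∧
      sketchCost k (countSketch p v) A ≤ (1 + ε) * diagCost w s p := by
  have hW : ∀ i ∈ s, 0 < binSum w s p (p i) := fun i hi =>
    (hw i).trans_le (le_binSum (fun l _ => (hw l).le) p hi)
  have hlow : ∀ z : Fin n → ℝ,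
      (1 - ε) * ∑ i, z i ^ 2 * w i ≤ ∑ j, (∑ i, z i * A i j) ^ 2 := fun z => by
    have := (abs_le.1 (hA z)).1; linarith
  have hup : ∀ z : Fin n → ℝ,
      ∑ j, (∑ i, z i * A i j) ^ 2 ≤ (1 + ε) * ∑ i, z i ^ 2 * w i := fun z => by
    have := (abs_le.1 (hA z)).2; linarith
  constructor
  -- The lower bound ignores the rank condition and treats each row of `X` separately.
  · refine le_csInf ⟨_, 0, by simp, fun i => Submodule.zero_mem _, rfl⟩ ?_
    rintro c ⟨X, -, hX, rfl⟩
    rw [diagCost_eq_sum, Finset.mul_sum]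
    refine Finset.sum_le_sum fun i _ => ?_
    obtain ⟨y, hy⟩ := (Submodule.mem_span_range_iff_exists_fun ℝ).1 (hX i)
    have h1 : ∀ j, X i j - A i j =
        ∑ l, (y (p l) * v l - if l = i then 1 else 0) * A l j := fun j => by
      rw [← sum_mul_countSketch_mul_sub]
      refine congrArg (· - A i j) ((congrFun hy j).symm.trans ?_)
      rw [Finset.sum_apply]
      rfl
    simp_rw [h1]
    refine le_trans (mul_le_mul_of_nonneg_left ?_ (by linarith)) (hlow _)
    rw [sum_coeff_sq w s p v hs hs']
    split_ifs with hi
    · have h2 : y (p i) ^ 2 * binSum w s p (p i) ≤ ∑ j, y j ^ 2 * binSum w s p j :=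
        Finset.single_le_sum (f := fun j => y j ^ 2 * binSum w s p j)
          (fun j _ => mul_nonneg (sq_nonneg _) (binSum_nonneg (fun l _ => (hw l).le) p j))
          (Finset.mem_univ _)
      have h3 := hW i hi
      have h4 := hs i hi
      -- Completing the square in `y (p i)`; the other coordinates of `y` only add to the error.
      have h5 : 0 ≤ (y (p i) * binSum w s p (p i) - v i * w i) ^ 2 / binSum w s p (p i) := by
        positivity
      have h6 : (y (p i) * binSum w s p (p i) - v i * w i) ^ 2 / binSum w s p (p i) =
          y (p i) ^ 2 * binSum w s p (p i) - 2 * y (p i) * v i * w i +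
            w i ^ 2 / binSum w s p (p i) := by
        field_simp
        linear_combination w i ^ 2 * h4
      linarith
    · rw [hs' i hi]
      have : 0 ≤ ∑ j, y j ^ 2 * binSum w s p j := Finset.sum_nonneg
        fun j _ => mul_nonneg (sq_nonneg _) (binSum_nonneg (fun l _ => (hw l).le) p j)
      linarith
  -- The minimizer of the square above: the coefficients of the orthogonal projection in the exactly
  -- orthogonal case.
  · let y : Fin n → Fin k → ℝ := fun i j =>
      if p i = j then v i * w i / binSum w s p j else 0
    let X : Matrix (Fin n) (Fin d) ℝ := Matrix.of fun i => ∑ l, y i l • (countSketch p v * A) l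
    have hXmul : X = Matrix.of y * (countSketch p v * A) := by
      ext i j
      simp [X, Matrix.mul_apply, Finset.sum_apply]
    have hX : ∀ i, X i ∈ Submodule.span ℝ (Set.range fun j => (countSketch p v * A) j) :=
      fun i => (Submodule.mem_span_range_iff_exists_fun ℝ).2 ⟨y i, rfl⟩
    have hrank : X.rank ≤ k := by
      rw [hXmul]
      refine (Matrix.rank_mul_le_left _ _).trans ?_
      simpa using Matrix.rank_le_card_width (Matrix.of y)
    have hle : sketchCost k (countSketch p v) A ≤ ∑ i, ∑ j, (X i j - A i j) ^ 2 := by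
      refine csInf_le ⟨0, ?_⟩ ⟨X, hrank, hX, rfl⟩
      rintro c ⟨X, -, -, rfl⟩
      exact Finset.sum_nonneg fun i _ => Finset.sum_nonneg fun j _ => sq_nonneg _
    refine hle.trans ?_
    rw [diagCost_eq_sum, Finset.mul_sum]
    refine Finset.sum_le_sum fun i _ => ?_
    have h1 : ∀ j, X i j - A i j =
        ∑ l, (y i (p l) * v l - if l = i then 1 else 0) * A l j := fun j => by
      rw [← sum_mul_countSketch_mul_sub]
      refine congrArg (· - A i j) ?_
      change (∑ l, y i l • (countSketch p v * A) l) j = _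
      rw [Finset.sum_apply]
      rfl
    simp_rw [h1]
    refine (hup _).trans (le_of_eq ?_)
    congr 1
    rw [sum_coeff_sq w s p v hs hs', Finset.sum_eq_single (p i)]
    · split_ifs with hi
      · have h3 := hW i hi
        have h4 := hs i hi
        simp only [y, if_true]
        field_simp
        linear_combination - w i ^ 2 * h4
      · simp [hs' i hi, y]
    · intro b _ hb
      simp [y, hb.symm]
    · simp

/-! ### Captured weight, and greedy runs as bin processes on sequences. -/

/-- The part of the total weight that is recovered by a sketch with filled columns `s` and
positions `p`. -/
def captured {ι κ : Type*} [DecidableEq κ] [Fintype κ] (w : ι → ℝ) (s : Finset ι) (p : ι → κ) :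
    ℝ :=
  ∑ j, binSum (fun i => w i ^ 2) s p j / binSum w s p j

/-- The change of `captured` when an element of weight `x` is added to the bin `j`. -/
def binGain {ι κ : Type*} [DecidableEq κ] (w : ι → ℝ) (s : Finset ι) (p : ι → κ) (x : ℝ)
    (j : κ) : ℝ :=
  (binSum (fun i => w i ^ 2) s p j + x ^ 2) / (binSum w s p j + x) -
    binSum (fun i => w i ^ 2) s p j / binSum w s p j

theorem diagCost_eq {n k : ℕ} (w : Fin n → ℝ) (s : Finset (Fin n)) (p : Fin n → Fin k) :
    diagCost w s p = ∑ i, w i - captured w s p := rfl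

theorem binSum_insert {ι κ : Type*} [DecidableEq ι] [DecidableEq κ] (f : ι → ℝ) {s : Finset ι}
    {i : ι} (hi : i ∉ s) (p : ι → κ) (j : κ) :
    binSum f (insert i s) p j = binSum f s p j + if p i = j then f i else 0 := by
  rw [binSum, binSum, Finset.filter_insert]
  split_ifs with h
  · rw [Finset.sum_insert (by simp [hi]), add_comm]
  · simp

theorem binSum_congr {ι κ : Type*} [DecidableEq κ] (f : ι → ℝ) {s : Finset ι} {p p' : ι → κ}
    (h : ∀ i ∈ s, p i = p' i) (j : κ) : binSum f s p j = binSum f s p' j := by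
  rw [binSum, binSum, Finset.filter_congr fun i hi => by rw [h i hi]]

theorem captured_congr {ι κ : Type*} [DecidableEq κ] [Fintype κ] (w : ι → ℝ) {s : Finset ι}
    {p p' : ι → κ} (h : ∀ i ∈ s, p i = p' i) : captured w s p = captured w s p' := by
  simp_rw [captured, binSum_congr _ h]

theorem binGain_congr {ι κ : Type*} [DecidableEq κ] (w : ι → ℝ) {s : Finset ι} {p p' : ι → κ}
    (h : ∀ i ∈ s, p i = p' i) (x : ℝ) (j : κ) : binGain w s p x j = binGain w s p' x j := by
  simp_rw [binGain, binSum_congr _ h]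

theorem captured_insert {ι κ : Type*} [DecidableEq ι] [DecidableEq κ] [Fintype κ] (w : ι → ℝ)
    {s : Finset ι} {i : ι} (hi : i ∉ s) (p : ι → κ) :
    captured w (insert i s) p = captured w s p + binGain w s p (w i) (p i) := by
  rw [← sub_eq_iff_eq_add', captured, captured, ← Finset.sum_sub_distrib,
    Finset.sum_eq_single (p i)]
  · simp [binSum_insert _ hi, binGain]
  · intro j _ hj
    simp [binSum_insert _ hi, hj.symm]
  · simp

theorem partialSketch_add_single {m n : ℕ} (π : Equiv.Perm (Fin n)) (p : Fin n → Fin m)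
    (σ : Fin n → ℝ) (a : Fin n) (j : Fin m) :
    partialSketch π p σ a + Matrix.single j (π a) (σ (π a)) =
      countSketch (Function.update p (π a) j) (fun i => if π.symm i ≤ a then σ i else 0) := by
  ext l i
  by_cases hi : i = π a
  · subst hi
    by_cases h : j = l <;> simp [partialSketch, countSketch, h]
  · have h1 : π.symm i ≠ a := fun h => hi (by simp [← h])
    have h2 : π.symm i ≤ a ↔ π.symm i < a := ⟨fun h => lt_of_le_of_ne h h1, le_of_lt⟩
    have h3 : π a ≠ i := fun h => hi h.symm
    simp only [partialSketch, countSketch, Matrix.add_apply, Matrix.of_apply,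
      Matrix.single_apply, h2, h3, Function.update_of_ne hi]
    by_cases h4 : π.symm i < a <;> by_cases h5 : p i = l <;> simp [h4, h5]

/-- The greedy algorithm processes the weights `x 0, …, x (n - 1)` in this order and puts the
`a`-th one into the bin `q a`, which up to the relative error `ε` minimizes the loss. -/
def IsGreedySeq {k : ℕ} (ε : ℝ) (n : ℕ) (x : ℕ → ℝ) (q : ℕ → Fin k) : Prop :=
  ∀ a < n, ∀ j,
    (1 - ε) * (∑ b ∈ Finset.range n, x b - captured x (Finset.range a) q -
        binGain x (Finset.range a) q (x a) (q a)) ≤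
      (1 + ε) * (∑ b ∈ Finset.range n, x b - captured x (Finset.range a) q -
        binGain x (Finset.range a) q (x a) j)

theorem sum_ite_perm_eq {n : ℕ} (π : Equiv.Perm (Fin n)) (f : Fin n → ℝ) (x : ℕ → ℝ)
    (hx : ∀ b : Fin n, x b = f (π b)) {a : ℕ} (ha : a ≤ n) {P : Fin n → Prop} {P' : ℕ → Prop}
    [DecidablePred P] [DecidablePred P'] (hP : ∀ b : Fin n, P' b ↔ P (π b)) :
    ∑ i ∈ (Finset.univ.filter fun i => (π.symm i : ℕ) < a) with P i, f i =
      ∑ b ∈ Finset.range a with P' b, x b := by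
  have h1 : (Finset.range a).filter P' = (Finset.range n).filter fun b => b < a ∧ P' b := by
    ext b
    simp only [Finset.mem_filter, Finset.mem_range]
    exact ⟨fun h => ⟨h.1.trans_le ha, h⟩, fun h => h.2⟩
  rw [h1, Finset.filter_filter, Finset.sum_filter, Finset.sum_filter,
    ← Fin.sum_univ_eq_sum_range (fun b => if b < a ∧ P' b then x b else 0) n,
    ← Equiv.sum_comp π]
  refine Finset.sum_congr rfl fun b _ => ?_
  simp [hP, hx]

theorem binSum_perm_eq {n k : ℕ} (π : Equiv.Perm (Fin n)) (f : Fin n → ℝ) (p : Fin n → Fin k)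
    (x : ℕ → ℝ) (q : ℕ → Fin k) (hx : ∀ b : Fin n, x b = f (π b))
    (hq : ∀ b : Fin n, q b = p (π b)) {a : ℕ} (ha : a ≤ n) (j : Fin k) :
    binSum f (Finset.univ.filter fun i => (π.symm i : ℕ) < a) p j =
      binSum x (Finset.range a) q j :=
  sum_ite_perm_eq π f x hx ha fun b => by rw [hq]

theorem captured_perm_eq {n k : ℕ} (π : Equiv.Perm (Fin n)) (w : Fin n → ℝ) (p : Fin n → Fin k)
    (x : ℕ → ℝ) (q : ℕ → Fin k) (hx : ∀ b : Fin n, x b = w (π b))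
    (hq : ∀ b : Fin n, q b = p (π b)) {a : ℕ} (ha : a ≤ n) :
    captured w (Finset.univ.filter fun i => (π.symm i : ℕ) < a) p =
      captured x (Finset.range a) q := by
  simp_rw [captured, binSum_perm_eq π w p x q hx hq ha]
  simp_rw [binSum_perm_eq π (fun i => w i ^ 2) p (fun b => x b ^ 2) q
    (fun b => by rw [hx]) hq ha]

theorem binGain_perm_eq {n k : ℕ} (π : Equiv.Perm (Fin n)) (w : Fin n → ℝ) (p : Fin n → Fin k)
    (x : ℕ → ℝ) (q : ℕ → Fin k) (hx : ∀ b : Fin n, x b = w (π b))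
    (hq : ∀ b : Fin n, q b = p (π b)) {a : ℕ} (ha : a ≤ n) (c : ℝ) (j : Fin k) :
    binGain w (Finset.univ.filter fun i => (π.symm i : ℕ) < a) p c j =
      binGain x (Finset.range a) q c j := by
  simp_rw [binGain, binSum_perm_eq π w p x q hx hq ha]
  simp_rw [binSum_perm_eq π (fun i => w i ^ 2) p (fun b => x b ^ 2) q
    (fun b => by rw [hx]) hq ha]

theorem sum_perm_eq {n : ℕ} (π : Equiv.Perm (Fin n)) (w : Fin n → ℝ) (x : ℕ → ℝ)
    (hx : ∀ b : Fin n, x b = w (π b)) : ∑ i, w i = ∑ b ∈ Finset.range n, x b := by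
  rw [← Fin.sum_univ_eq_sum_range, ← Equiv.sum_comp π]
  exact Finset.sum_congr rfl fun b _ => (hx b).symm

theorem diagCost_update_eq {n k : ℕ} (π : Equiv.Perm (Fin n)) (w : Fin n → ℝ)
    (p : Fin n → Fin k) (x : ℕ → ℝ) (q : ℕ → Fin k) (hx : ∀ b : Fin n, x b = w (π b))
    (hq : ∀ b : Fin n, q b = p (π b)) (a : Fin n) (j : Fin k) :
    diagCost w (Finset.univ.filter fun i => π.symm i ≤ a) (Function.update p (π a) j) =
      ∑ b ∈ Finset.range n, x b - captured x (Finset.range a) q -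
        binGain x (Finset.range a) q (x a) j := by
  have h1 : (Finset.univ.filter fun i => π.symm i ≤ a) =
      insert (π a) (Finset.univ.filter fun i => (π.symm i : ℕ) < a) := by
    ext i
    simp only [Finset.mem_filter, Finset.mem_univ, true_and, Finset.mem_insert,
      Fin.val_fin_lt, le_iff_lt_or_eq, Equiv.symm_apply_eq]
    tauto
  have h2 : π a ∉ (Finset.univ.filter fun i => (π.symm i : ℕ) < a) := by simp
  have h3 : ∀ i ∈ (Finset.univ.filter fun i => (π.symm i : ℕ) < a),
      Function.update p (π a) j i = p i := fun i hi =>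
    Function.update_of_ne (by rintro rfl; exact h2 hi) _ _
  rw [diagCost_eq, h1, captured_insert _ h2, captured_congr _ h3, binGain_congr _ h3,
    Function.update_self, captured_perm_eq π w p x q hx hq a.2.le,
    binGain_perm_eq π w p x q hx hq a.2.le, sum_perm_eq π w x hx, hx]
  ring

theorem IsSign.sq_eq_one {n : ℕ} {σ : Fin n → ℝ} (h : IsSign σ) (i : Fin n) : σ i ^ 2 = 1 := by
  rcases h i with h | h <;> rw [h] <;> norm_num

theorem isGreedySeq_of_isGreedyRun {n d N k : ℕ} {ε : ℝ} (hε : ε ≤ 1) {w : Fin n → ℝ}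
    (hw : ∀ i, 0 < w i) {A : Fin N → Matrix (Fin n) (Fin d) ℝ} {T : Finset (Fin N)}
    (hT : T.Nonempty) (hA : ∀ t ∈ T, NearOrthogonal ε w (A t)) {π : Equiv.Perm (Fin n)}
    {σ : Fin n → ℝ} (hσ : IsSign σ) {p : Fin n → Fin k} (hp : IsGreedyRun k T A π σ p)
    (x : ℕ → ℝ) (q : ℕ → Fin k) (hx : ∀ b : Fin n, x b = w (π b))
    (hq : ∀ b : Fin n, q b = p (π b)) : IsGreedySeq ε n x q := by
  intro a ha j
  have key : ∀ l, ∀ t ∈ T, _ := fun l t ht => sketchCost_bounds hε hw (hA t ht)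
    (Finset.univ.filter fun i => π.symm i ≤ ⟨a, ha⟩) (Function.update p (π ⟨a, ha⟩) l)
    (fun i => if π.symm i ≤ ⟨a, ha⟩ then σ i else 0)
    (fun i hi => by simpa [(Finset.mem_filter.1 hi).2] using hσ.sq_eq_one i)
    (fun i hi => by
      have : ¬ π.symm i ≤ ⟨a, ha⟩ := fun h => hi (by simpa using h)
      simp [this])
  have h2 := hp.2 ⟨a, ha⟩ j
  simp only [partialSketch_add_single] at h2
  -- The bounds do not depend on `t`, so both sums are `T.card` copies of one number, which cancels.
  have h3 := (Finset.sum_le_sum fun t ht => (key (p (π ⟨a, ha⟩)) t ht).1).trans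
    (h2.trans (Finset.sum_le_sum fun t ht => (key j t ht).2))
  rw [Finset.sum_const, Finset.sum_const, nsmul_eq_mul, nsmul_eq_mul] at h3
  have h4 := le_of_mul_le_mul_left h3 (by exact_mod_cast hT.card_pos)
  rw [diagCost_update_eq π w p x q hx hq, diagCost_update_eq π w p x q hx hq,
    ← hq ⟨a, ha⟩] at h4
  exact h4

/-! ### Greedy on heavy elements followed by unit weights. -/

theorem binSum_range_succ {κ : Type*} [DecidableEq κ] (f : ℕ → ℝ) (a : ℕ) (q : ℕ → κ) (j : κ) :
    binSum f (Finset.range (a + 1)) q j =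
      binSum f (Finset.range a) q j + if q a = j then f a else 0 := by
  rw [Finset.range_add_one, binSum_insert _ (by simp)]

theorem captured_range_succ {κ : Type*} [DecidableEq κ] [Fintype κ] (x : ℕ → ℝ) (a : ℕ)
    (q : ℕ → κ) :
    captured x (Finset.range (a + 1)) q =
      captured x (Finset.range a) q + binGain x (Finset.range a) q (x a) (q a) := by
  rw [Finset.range_add_one, captured_insert _ (by simp)]

theorem binSum_eq_of_alone {ι κ : Type*} [DecidableEq κ] (f : ι → ℝ) {s : Finset ι} {q : ι → κ}
    {b : ι} (hb : b ∈ s) (h : ∀ b' ∈ s, b' ≠ b → q b' ≠ q b) : binSum f s q (q b) = f b := by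
  rw [binSum, Finset.sum_eq_single b]
  · intro c hc hcb
    exact absurd (Finset.mem_filter.1 hc).2 (h c (Finset.mem_filter.1 hc).1 hcb)
  · intro h
    exact (h (by simp [hb])).elim

theorem binSum_eq_zero {ι κ : Type*} [DecidableEq κ] (f : ι → ℝ) {s : Finset ι} {q : ι → κ}
    {j : κ} (h : ∀ b ∈ s, q b ≠ j) : binSum f s q j = 0 :=
  Finset.sum_eq_zero fun b hb => absurd (Finset.mem_filter.1 hb).2 (h b (Finset.mem_filter.1 hb).1)

theorem binSum_sq_nonneg {ι κ : Type*} [DecidableEq κ] (x : ι → ℝ) (s : Finset ι) (q : ι → κ)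
    (j : κ) : 0 ≤ binSum (fun i => x i ^ 2) s q j :=
  binSum_nonneg (fun _ _ => sq_nonneg _) q j

/-- Elements that are alone in their bins are captured completely. -/
theorem sum_le_captured {ι κ : Type*} [DecidableEq κ] [Fintype κ] {x : ι → ℝ} {s t : Finset ι}
    {q : ι → κ} (hx : ∀ i ∈ s, 0 ≤ x i) (hts : t ⊆ s)
    (h : ∀ b ∈ t, ∀ b' ∈ s, b' ≠ b → q b' ≠ q b) : ∑ b ∈ t, x b ≤ captured x s q := by
  have hinj : Set.InjOn q t := fun b hb b' hb' hbb => by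
    by_contra hne
    exact h b' hb' b (hts hb) hne hbb
  calc ∑ b ∈ t, x b = ∑ b ∈ t, binSum (fun i => x i ^ 2) s q (q b) / binSum x s q (q b) := by
        refine Finset.sum_congr rfl fun b hb => ?_
        rw [binSum_eq_of_alone _ (hts hb) (h b hb), binSum_eq_of_alone _ (hts hb) (h b hb), sq,
          mul_self_div_self]
    _ = ∑ j ∈ t.image q, binSum (fun i => x i ^ 2) s q j / binSum x s q j :=
        (Finset.sum_image (f := fun j => binSum (fun i => x i ^ 2) s q j / binSum x s q j)
          hinj).symm
    _ ≤ captured x s q := Finset.sum_le_sum_of_subset_of_nonneg (Finset.subset_univ _)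
        fun j _ _ => div_nonneg (binSum_sq_nonneg _ _ _ _) (binSum_nonneg hx q j)

theorem captured_nonneg {ι κ : Type*} [DecidableEq κ] [Fintype κ] {x : ι → ℝ} {s : Finset ι}
    (q : ι → κ) (hx : ∀ i ∈ s, 0 ≤ x i) : 0 ≤ captured x s q := by
  simpa using sum_le_captured (t := ∅) hx (Finset.empty_subset _) (by simp)

theorem exists_forall_ne_of_lt {k m : ℕ} (h : m < k) (q : ℕ → Fin k) :
    ∃ j, ∀ b < m, q b ≠ j := by
  obtain ⟨j, -, hj⟩ := Finset.exists_mem_notMem_of_card_lt_card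
    (s := (Finset.range m).image q) (t := Finset.univ)
    ((Finset.card_image_le.trans_eq (Finset.card_range m)).trans_lt (by simpa using h))
  exact ⟨j, fun b hb hbj => hj (Finset.mem_image.2 ⟨b, Finset.mem_range.2 hb, hbj⟩)⟩

/-- With `s` heavy elements, which come first, and light elements of weight `1`, the greedy
algorithm gives every heavy element a bin of its own. -/
theorem IsGreedySeq.ne_of_heavy {k s n : ℕ} {ε μ : ℝ} {x : ℕ → ℝ} {q : ℕ → Fin k} (hk : s < k)
    (hsn : s ≤ n) (hx1 : ∀ b < s, x b = μ) (hx2 : ∀ b, s ≤ b → b < n → x b = 1) (hμ : 3 ≤ μ)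
    (hε0 : 0 ≤ ε) (hε : ε * n ≤ 1 / 16) (hq : IsGreedySeq ε n x q) :
    ∀ a ≤ n, ∀ b < s, b < a → ∀ b' < a, b' ≠ b → q b' ≠ q b := by
  have hε1 : n = 0 ∨ ε ≤ 1 / 16 := by
    rcases Nat.eq_zero_or_pos n with h | h
    · exact Or.inl h
    · right
      have : (1 : ℝ) ≤ n := by exact_mod_cast h
      nlinarith
  have hpos : ∀ b < n, 0 < x b := fun b hb => by
    rcases lt_or_ge b s with h | h
    · rw [hx1 b h]; linarith
    · rw [hx2 b h hb]; norm_num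
  have htot : ∑ b ∈ Finset.range n, x b = s * μ + (n - s) := by
    rw [← Finset.sum_range_add_sum_Ico _ hsn, Finset.sum_congr rfl
      (fun b hb => hx1 b (Finset.mem_range.1 hb)), Finset.sum_congr rfl
      (fun b hb => hx2 b (Finset.mem_Ico.1 hb).1 (Finset.mem_Ico.1 hb).2)]
    simp [Nat.cast_sub hsn]
  have hsn' : (s : ℝ) ≤ n := by exact_mod_cast hsn
  intro a
  induction a with
  | zero => intro _ b _ hb; omega
  | succ a ih =>
    intro ha
    have ih := ih (by omega)
    have hpa : ∀ i ∈ Finset.range a, 0 ≤ x i := fun i hi =>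
      (hpos i (by have := Finset.mem_range.1 hi; omega)).le
    have hcap0 := captured_nonneg q hpa
    have key : ∀ b < s, b < a → q a ≠ q b := by
      intro b hbs hba hqa
      have hε' : ε ≤ 1 / 16 := hε1.resolve_left (by omega)
      have halone : ∀ b' ∈ Finset.range a, b' ≠ b → q b' ≠ q b := fun b' hb' =>
        ih b hbs hba b' (Finset.mem_range.1 hb')
      have hbmem := Finset.mem_range.2 hba
      have hg1 : binGain x (Finset.range a) q (x a) (q a) = (μ ^ 2 + x a ^ 2) / (μ + x a) - μ := by
        rw [binGain, hqa, binSum_eq_of_alone _ hbmem halone, binSum_eq_of_alone _ hbmem halone,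
          hx1 b hbs, sq μ, mul_self_div_self]
      rcases lt_or_ge a s with has | has
      -- A heavy element gains `μ` in an empty bin and `0` beside another heavy one. The slack is at
      -- most `2 ε` times the total weight, hence at most `μ / 8`.
      · obtain ⟨j, hj⟩ := exists_forall_ne_of_lt (has.trans hk) q
        have hj' : ∀ b ∈ Finset.range a, q b ≠ j := fun b hb => hj b (Finset.mem_range.1 hb)
        have hg2 : binGain x (Finset.range a) q (x a) j = μ := by
          rw [binGain, binSum_eq_zero _ hj', binSum_eq_zero _ hj', hx1 a has]
          simp [sq]
        have hg1' : binGain x (Finset.range a) q (x a) (q a) = 0 := by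
          rw [hg1, hx1 a has]
          field_simp
          ring
        have := hq a ha j
        rw [hg1', hg2, htot] at this
        have h1 : ε * (s * μ + (n - s)) ≤ 1 / 16 * μ := by
          calc ε * (s * μ + (n - s)) ≤ ε * (n * μ) := by
                apply mul_le_mul_of_nonneg_left _ hε0
                nlinarith
            _ = (ε * n) * μ := by ring
            _ ≤ _ := by apply mul_le_mul_of_nonneg_right hε; linarith
        nlinarith [mul_nonneg hε0 hcap0]
      -- Some bin has no heavy element. A unit weight loses nothing there, but at least `1 / 2`
      -- beside a heavy element, since `μ ≥ 3`. The heavy weight is already captured, so the slack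
      -- is now at most `1 / 8`, independently of `μ`.
      · obtain ⟨j, hj⟩ := exists_forall_ne_of_lt hk q
        have hxa := hx2 a has ha
        have hbin : binSum (fun i => x i ^ 2) (Finset.range a) q j =
            binSum x (Finset.range a) q j := by
          refine Finset.sum_congr rfl fun b hb => ?_
          rw [Finset.mem_filter, Finset.mem_range] at hb
          have : s ≤ b := by
            by_contra h
            exact hj b (by omega) hb.2
          simp [hx2 b this (by omega)]
        have hbin0 := binSum_nonneg hpa q j
        -- The gain is `1 - W / W`, which is `0`, or `1` for an empty bin because `0 / 0 = 0`.
        have hg2 : 0 ≤ binGain x (Finset.range a) q (x a) j := by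
          rw [binGain, hbin, hxa, one_pow, div_self (by positivity)]
          linarith [div_self_le_one (binSum x (Finset.range a) q j)]
        have hg1' : binGain x (Finset.range a) q (x a) (q a) ≤ - 1 / 2 := by
          rw [hg1, hxa, sub_le_iff_le_add, div_le_iff₀ (by linarith)]
          nlinarith
        have hcap : s * μ ≤ captured x (Finset.range a) q := by
          have := sum_le_captured (t := Finset.range s) hpa
            (Finset.range_subset_range.2 has) (fun b hb b' hb' =>
              ih b (Finset.mem_range.1 hb) ((Finset.mem_range.1 hb).trans_le has) b'
              (Finset.mem_range.1 hb'))
          rwa [Finset.sum_congr rfl (fun b hb => hx1 b (Finset.mem_range.1 hb)),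
            Finset.sum_const, Finset.card_range, nsmul_eq_mul] at this
        have := hq a ha j
        rw [htot] at this
        have hs0 : (0 : ℝ) ≤ s := by positivity
        have h1 : ε * (s * μ + (n - s) - captured x (Finset.range a) q) ≤ 1 / 16 := by
          refine le_trans ?_ hε
          apply mul_le_mul_of_nonneg_left _ hε0
          linarith
        nlinarith [mul_nonneg hε0 hg2]
    intro b hbs hba b' hb'a hne
    rcases Nat.lt_succ_iff_lt_or_eq.1 hba with hb | rfl
    · rcases Nat.lt_succ_iff_lt_or_eq.1 hb'a with hb' | rfl
      · exact ih b hbs hb b' hb' hne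
      · exact key b hbs hb
    · have : b' < b := by omega
      exact (key b' (by omega) this).symm

theorem IsGreedySeq.loss_le_of_heavy {k s n : ℕ} {ε μ : ℝ} {x : ℕ → ℝ} {q : ℕ → Fin k}
    (hk : s < k) (hsn : s ≤ n) (hx1 : ∀ b < s, x b = μ) (hx2 : ∀ b, s ≤ b → b < n → x b = 1)
    (hμ : 3 ≤ μ) (hε0 : 0 ≤ ε) (hε : ε * n ≤ 1 / 16) (hq : IsGreedySeq ε n x q) :
    ∑ b ∈ Finset.range n, x b - captured x (Finset.range n) q ≤ n - s := by
  have h := IsGreedySeq.ne_of_heavy hk hsn hx1 hx2 hμ hε0 hε hq n le_rfl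
  have hpos : ∀ b ∈ Finset.range n, 0 ≤ x b := fun b hb => by
    rcases lt_or_ge b s with h | h
    · rw [hx1 b h]; linarith
    · rw [hx2 b h (Finset.mem_range.1 hb)]; norm_num
  have h1 := sum_le_captured (t := Finset.range s) hpos (Finset.range_subset_range.2 hsn)
    (fun b hb b' hb' => h b (Finset.mem_range.1 hb) ((Finset.mem_range.1 hb).trans_le hsn) b'
      (Finset.mem_range.1 hb'))
  have h2 : ∑ b ∈ Finset.Ico s n, x b = n - s := by
    rw [Finset.sum_congr rfl
      (fun b hb => hx2 b (Finset.mem_Ico.1 hb).1 (Finset.mem_Ico.1 hb).2)]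
    simp [Nat.cast_sub hsn]
  rw [← Finset.sum_range_add_sum_Ico _ hsn]
  linarith

/-! ### Greedy on geometrically decreasing levels of weights. -/

theorem IsGreedySeq.binGain_le {k n : ℕ} {x : ℕ → ℝ} {q : ℕ → Fin k} (hq : IsGreedySeq 0 n x q)
    {a : ℕ} (ha : a < n) (j : Fin k) :
    binGain x (Finset.range a) q (x a) j ≤ binGain x (Finset.range a) q (x a) (q a) := by
  have := hq a ha j
  linarith

/-- This form shows that the sign of the gain is governed by `Q - x W`. That quantity is unchanged
when further copies of `x` enter the bin, while the denominator grows. -/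
theorem binGain_eq {ι κ : Type*} [DecidableEq κ] {w : ι → ℝ} {s : Finset ι} {p : ι → κ} {x : ℝ}
    {j : κ} (hW : 0 < binSum w s p j) (hx : 0 < x) :
    binGain w s p x j = - (x * (binSum (fun i => w i ^ 2) s p j - x * binSum w s p j) /
      (binSum w s p j * (binSum w s p j + x))) := by
  rw [binGain]
  field_simp
  ring

/-- With `binGain_eq`, this makes the gain in a non-empty bin non-positive when weights arrive in
non-increasing order. -/
theorem mul_binSum_le_binSum_sq {ι κ : Type*} [DecidableEq κ] {w : ι → ℝ} {s : Finset ι} {x : ℝ}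
    (p : ι → κ) (hx : 0 ≤ x) (h : ∀ i ∈ s, x ≤ w i) (j : κ) :
    x * binSum w s p j ≤ binSum (fun i => w i ^ 2) s p j := by
  rw [binSum, binSum, Finset.mul_sum]
  refine Finset.sum_le_sum fun i hi => ?_
  nlinarith [h i (Finset.mem_filter.1 hi).1]

/-- As long as there are empty bins, the greedy algorithm uses them. -/
theorem IsGreedySeq.ne_of_le {k n : ℕ} {x : ℕ → ℝ} {q : ℕ → Fin k} (hq : IsGreedySeq 0 n x q)
    (hpos : ∀ b < n, 0 < x b) (hanti : ∀ a b, a ≤ b → b < n → x b ≤ x a) :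
    ∀ a ≤ n, a ≤ k → ∀ b < a, ∀ b' < a, b' ≠ b → q b' ≠ q b := by
  intro a
  induction a with
  | zero => intro _ _ b hb; omega
  | succ a ih =>
    intro ha hak
    have ih := ih (by omega) (by omega)
    have key : ∀ b < a, q a ≠ q b := by
      intro b hba hqa
      have hxa := hpos a ha
      have hW : 0 < binSum x (Finset.range a) q (q a) := by
        rw [hqa]
        exact (hpos b (by omega)).trans_le (le_binSum (fun i hi =>
          (hpos i (by have := Finset.mem_range.1 hi; omega)).le) q (Finset.mem_range.2 hba))
      obtain ⟨j, hj⟩ := exists_forall_ne_of_lt (m := a) (by omega) q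
      have hj' : ∀ b ∈ Finset.range a, q b ≠ j := fun b hb => hj b (Finset.mem_range.1 hb)
      have h1 := hq.binGain_le ha j
      rw [binGain_eq hW hxa, binGain, binSum_eq_zero _ hj', binSum_eq_zero _ hj'] at h1
      have h2 := mul_binSum_le_binSum_sq q hxa.le (fun i hi => hanti i a
        (Finset.mem_range.1 hi).le ha) (q a)
      have h3 : 0 ≤ x a * (binSum (fun i => x i ^ 2) (Finset.range a) q (q a) -
          x a * binSum x (Finset.range a) q (q a)) /
          (binSum x (Finset.range a) q (q a) * (binSum x (Finset.range a) q (q a) + x a)) :=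
        div_nonneg (mul_nonneg hxa.le (by linarith)) (by positivity)
      have h4 : (0 + x a ^ 2) / (0 + x a) - 0 / 0 = x a := by
        simp [sq]
      linarith
    intro b hb b' hb' hne
    rcases Nat.lt_succ_iff_lt_or_eq.1 hb with hb | rfl
    · rcases Nat.lt_succ_iff_lt_or_eq.1 hb' with hb' | rfl
      · exact ih b hb b' hb' hne
      · exact key b hb
    · exact (key b' (by omega)).symm

theorem exists_eq_of_forall_ne {k : ℕ} {q : ℕ → Fin k}
    (h : ∀ b < k, ∀ b' < k, b' ≠ b → q b' ≠ q b) (j : Fin k) : ∃ b < k, q b = j := by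
  have hinj : Function.Injective fun b : Fin k => q b := fun b b' hbb => by
    by_contra hne
    exact h b' b'.2 b b.2 (fun h => hne (Fin.ext h)) hbb
  obtain ⟨b, hb⟩ := (Finite.injective_iff_surjective.1 hinj) j
  exact ⟨b, b.2, hb⟩

theorem binSum_range_add {κ : Type*} [DecidableEq κ] {f : ℕ → ℝ} {c : ℝ} {N t : ℕ} {q : ℕ → κ}
    {l : κ} (hf : ∀ b, N ≤ b → b < N + t → f b = c) (hq : ∀ b, N ≤ b → b < N + t → q b = l)
    (j : κ) :
    binSum f (Finset.range (N + t)) q j =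
      binSum f (Finset.range N) q j + if l = j then t * c else 0 := by
  induction t with
  | zero => simp
  | succ t ih =>
    rw [← add_assoc, binSum_range_succ, ih (fun b h1 h2 => hf b h1 (by omega))
      (fun b h1 h2 => hq b h1 (by omega)), hf (N + t) (by omega) (by omega),
      hq (N + t) (by omega) (by omega)]
    split_ifs
    · push_cast; ring
    · ring

/-- Once all bins are used, the elements of weight `θ` are added without loss, to bins that contain
only elements of weight `θ`. -/
theorem IsGreedySeq.bins_of_level {k n N : ℕ} {θ : ℝ} {x : ℕ → ℝ} {q : ℕ → Fin k}
    (hq : IsGreedySeq 0 n x q) (hk : 0 < k) (hθ : 0 < θ) (hpos : ∀ b < n, 0 < x b)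
    (hanti : ∀ a b, a ≤ b → b < n → x b ≤ x a) (hkN : k ≤ N) (hN : N ≤ n)
    (h1 : ∀ b < k, x b = θ ∨ 4 * θ ≤ x b) (h2 : ∀ b, k - 1 ≤ b → b < N → x b = θ) :
    ∀ t, k + t ≤ N →
      (∀ j, θ ≤ binSum x (Finset.range (k + t)) q j ∧
        (binSum (fun i => x i ^ 2) (Finset.range (k + t)) q j =
          θ * binSum x (Finset.range (k + t)) q j ∨
        binSum (fun i => x i ^ 2) (Finset.range (k + t)) q j =
          binSum x (Finset.range (k + t)) q j ^ 2 ∧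
          4 * θ ≤ binSum x (Finset.range (k + t)) q j)) ∧
      binSum (fun i => x i ^ 2) (Finset.range (k + t)) q (q (k - 1)) =
          θ * binSum x (Finset.range (k + t)) q (q (k - 1)) ∧
      ∑ b ∈ Finset.range k, x b ≤ captured x (Finset.range (k + t)) q := by
  have hne := hq.ne_of_le hpos hanti k (by omega) le_rfl
  have hne' : ∀ b < k, ∀ b' ∈ Finset.range k, b' ≠ b → q b' ≠ q b := fun b hb b' hb' =>
    hne b hb b' (Finset.mem_range.1 hb')
  intro t
  induction t with
  | zero =>
    intro _
    refine ⟨fun j => ?_, ?_, ?_⟩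
    · obtain ⟨b, hb, rfl⟩ := exists_eq_of_forall_ne hne j
      rw [add_zero, binSum_eq_of_alone _ (Finset.mem_range.2 hb) (hne' b hb),
        binSum_eq_of_alone _ (Finset.mem_range.2 hb) (hne' b hb)]
      rcases h1 b hb with h | h
      · exact ⟨h.ge, Or.inl (by rw [h]; ring)⟩
      · exact ⟨by linarith, Or.inr ⟨rfl, h⟩⟩
    · have hb : k - 1 < k := by omega
      rw [add_zero, binSum_eq_of_alone _ (Finset.mem_range.2 hb) (hne' _ hb),
        binSum_eq_of_alone _ (Finset.mem_range.2 hb) (hne' _ hb), h2 _ le_rfl (by omega)]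
      ring
    · exact sum_le_captured (fun i hi => (hpos i (by
        have := Finset.mem_range.1 hi; omega)).le) subset_rfl
        (fun b hb => hne' b (Finset.mem_range.1 hb))
  | succ t ih =>
    intro ht
    obtain ⟨i1, i2, i3⟩ := ih (by omega)
    have hx : x (k + t) = θ := h2 _ (by omega) (by omega)
    have hg := hq.binGain_le (a := k + t) (by omega) (q (k - 1))
    rw [hx, binGain_eq (hθ.trans_le (i1 _).1) hθ, i2, sub_self, mul_zero, zero_div, neg_zero] at hg
    -- Adding `θ` to the bin of element `k - 1` is free, whereas a bin with a single heavier element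
    -- would strictly lose.
    have hpure : binSum (fun i => x i ^ 2) (Finset.range (k + t)) q (q (k + t)) =
        θ * binSum x (Finset.range (k + t)) q (q (k + t)) := by
      rcases (i1 (q (k + t))).2 with h | ⟨h, h'⟩
      · exact h
      · exfalso
        set W := binSum x (Finset.range (k + t)) q (q (k + t)) with hW
        have hWpos : 0 < W := by linarith
        rw [binGain_eq (hW ▸ hWpos) hθ, h, ← hW] at hg
        have : 0 < θ * (W ^ 2 - θ * W) / (W * (W + θ)) := by
          apply div_pos _ (by positivity)
          apply mul_pos hθ
          nlinarith
        linarith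
    have hstep : ∀ j, binSum (fun i => x i ^ 2) (Finset.range (k + t)) q j =
          θ * binSum x (Finset.range (k + t)) q j →
        binSum (fun i => x i ^ 2) (Finset.range (k + t + 1)) q j =
          θ * binSum x (Finset.range (k + t + 1)) q j := by
      intro j hj
      rw [binSum_range_succ, binSum_range_succ, hj, hx]
      split_ifs <;> ring
    rw [← add_assoc]
    refine ⟨fun j => ?_, hstep _ i2, ?_⟩
    · by_cases hj : q (k + t) = j
      · subst hj
        refine ⟨?_, Or.inl (hstep _ hpure)⟩
        rw [binSum_range_succ, if_pos rfl, hx]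
        linarith [(i1 (q (k + t))).1]
      · simpa [binSum_range_succ, hj] using i1 j
    · rw [captured_range_succ, hx]
      linarith

/-- The elements of one level all go to the same bin, if they are lighter than those before. -/
theorem IsGreedySeq.eq_of_level {k n N N' : ℕ} {w : ℝ} {x : ℕ → ℝ} {q : ℕ → Fin k}
    (hq : IsGreedySeq 0 n x q) (hw : 0 < w) (hN' : N' ≤ n)
    (hW : ∀ j, 0 < binSum x (Finset.range N) q j)
    (hQ : ∀ j, w * binSum x (Finset.range N) q j < binSum (fun i => x i ^ 2) (Finset.range N) q j)
    (h3 : ∀ b, N ≤ b → b < N' → x b = w) :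
    ∀ t, N + t ≤ N' → ∀ b, N ≤ b → b < N + t → q b = q N := by
  intro t
  induction t with
  | zero => intro _ b hb hb'; omega
  | succ t ih =>
    intro ht
    have ih := ih (by omega)
    have key : q (N + t) = q N := by
      rcases Nat.eq_zero_or_pos t with rfl | htpos
      · rfl
      by_contra hne
      have e1 := fun j => binSum_range_add (f := x) (c := w)
        (fun b h1 h2 => h3 b h1 (by omega)) ih j
      have e2 := fun j => binSum_range_add (f := fun i => x i ^ 2) (c := w ^ 2)
        (fun b h1 h2 => by rw [h3 b h1 (by omega)]) ih j
      have g1 := hq.binGain_le (a := N + t) (by omega) (q N)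
      have g2 := hq.binGain_le (a := N) (by omega) (q (N + t))
      rw [h3 _ (by omega) (by omega)] at g1 g2
      have g3 : binGain x (Finset.range (N + t)) q w (q (N + t)) =
          binGain x (Finset.range N) q w (q (N + t)) := by
        rw [binGain, binGain, e1, e2, if_neg (Ne.symm hne), if_neg (Ne.symm hne), add_zero,
          add_zero]
      have t0 : (0 : ℝ) < t := by exact_mod_cast htpos
      have hW0 := hW (q N)
      have hQ0 := hQ (q N)
      have e1' := e1 (q N)
      have e2' := e2 (q N)
      rw [if_pos rfl] at e1' e2'
      have hWt : 0 < binSum x (Finset.range (N + t)) q (q N) := by rw [e1']; positivity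
      rw [g3] at g1
      -- Bin `q (N + t)` is untouched since time `N`, so switching to it would mean that the gain in
      -- bin `q N` has not increased. But `Q - w W` stayed the same and positive there while `W`
      -- grew, so adding another `w` became strictly cheaper.
      have g4 := g1.trans g2
      rw [binGain_eq hWt hw, binGain_eq hW0 hw, e1', e2', neg_le_neg_iff] at g4
      set W := binSum x (Finset.range N) q (q N)
      set Q := binSum (fun i => x i ^ 2) (Finset.range N) q (q N)
      have hD : 0 < w * (Q - w * W) := mul_pos hw (by linarith)
      have hnum : w * (Q + t * w ^ 2 - w * (W + t * w)) = w * (Q - w * W) := by ring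
      rw [hnum, div_le_div_iff_of_pos_left hD (by positivity) (by positivity)] at g4
      have : 0 < t * w := by positivity
      nlinarith
    intro b hb hb'
    rcases Nat.lt_succ_iff_lt_or_eq.1 hb' with h | rfl
    · exact ih b hb h
    · exact key

/-- For weights that decrease by the factor `4` from one level to the next, the greedy algorithm
captures the `k` largest weights up to a small loss. -/
theorem IsGreedySeq.sum_sub_le_captured {k n N N' : ℕ} {θ : ℝ} {x : ℕ → ℝ} {q : ℕ → Fin k}
    (hq : IsGreedySeq 0 n x q) (hk : 0 < k) (hθ : 0 < θ) (hpos : ∀ b < n, 0 < x b)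
    (hanti : ∀ a b, a ≤ b → b < n → x b ≤ x a) (hkN : k ≤ N)
    (h1 : ∀ b < k, x b = θ ∨ 4 * θ ≤ x b) (h2 : ∀ b, k - 1 ≤ b → b < N → x b = θ)
    (hN : N ≤ N') (hN' : N' ≤ n) (h3 : ∀ b, N ≤ b → b < N' → x b = θ / 4)
    (h4 : ∑ b ∈ Finset.Ico N' n, x b ≤ ((N' : ℝ) - N) * (θ / 4)) :
    ∑ b ∈ Finset.range k, x b - 2 * θ ≤ captured x (Finset.range n) q := by
  have hB := hq.bins_of_level hk hθ hpos hanti hkN (hN.trans hN') h1 h2 (N - k) (by omega)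
  rw [Nat.add_sub_cancel' hkN] at hB
  obtain ⟨i1, i2, i3⟩ := hB
  -- Without a level of weight `θ / 4`, hypothesis `h4` forces the tail to be empty.
  rcases hN.eq_or_lt with rfl | hlt
  · have : N = n := by
      by_contra hne
      have : 0 < ∑ b ∈ Finset.Ico N n, x b := Finset.sum_pos
        (fun b hb => hpos b (Finset.mem_Ico.1 hb).2) ⟨N, by simp; omega⟩
      simp only [sub_self, zero_mul] at h4
      linarith
    rw [← this]
    linarith
  have hW : ∀ j, 0 < binSum x (Finset.range N) q j := fun j => hθ.trans_le (i1 j).1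
  have hw : 0 < θ / 4 := by positivity
  have hQ : ∀ j, θ / 4 * binSum x (Finset.range N) q j <
      binSum (fun i => x i ^ 2) (Finset.range N) q j := by
    intro j
    have := hW j
    rcases (i1 j).2 with h | ⟨h, h'⟩ <;> rw [h] <;> nlinarith
  have hstick := hq.eq_of_level hw hN' hW hQ h3
  set l := q N with hl
  -- The first element of the next level loses at most `3 / 5` of its weight in a bin of pure `θ`,
  -- but at least `15 / 17` in a bin with a single heavier element.
  have hpure : binSum (fun i => x i ^ 2) (Finset.range N) q l =
      θ * binSum x (Finset.range N) q l := by
    rcases (i1 l).2 with h | ⟨h, h'⟩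
    · exact h
    exfalso
    have g := hq.binGain_le (a := N) (by omega) (q (k - 1))
    rw [h3 N le_rfl hlt, ← hl, binGain_eq (hW _) hw, binGain_eq (hW _) hw, i2, h,
      neg_le_neg_iff] at g
    have hV := (i1 (q (k - 1))).1
    set V := binSum x (Finset.range N) q (q (k - 1))
    set W := binSum x (Finset.range N) q l
    have hV0 : 0 < V := hθ.trans_le hV
    have hW0 : 0 < W := by linarith
    have e1 : θ / 4 * (θ * V - θ / 4 * V) / (V * (V + θ / 4)) =
        θ / 4 * ((3 / 4 * θ) / (V + θ / 4)) := by
      field_simp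
      ring
    have e2 : θ / 4 * (W ^ 2 - θ / 4 * W) / (W * (W + θ / 4)) =
        θ / 4 * ((W - θ / 4) / (W + θ / 4)) := by
      field_simp
    rw [e1, e2] at g
    have g' := le_of_mul_le_mul_left g hw
    rw [div_le_div_iff₀ (by positivity) (by positivity)] at g'
    nlinarith
  obtain ⟨t, rfl⟩ := Nat.exists_eq_add_of_le hN
  have ht : (0 : ℝ) < t := by exact_mod_cast (by omega : 0 < t)
  have e1 := fun j => binSum_range_add (f := x) (c := θ / 4) h3 (hstick t le_rfl) j
  have e2 := fun j => binSum_range_add (f := fun i => x i ^ 2) (c := (θ / 4) ^ 2)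
    (fun b h1 h2 => by rw [h3 b h1 h2]) (hstick t le_rfl) j
  -- Bin `l` captured exactly `θ`, so filling it with the next level costs at most that: the first
  -- of the two `θ`.
  have hC : captured x (Finset.range N) q - θ ≤ captured x (Finset.range (N + t)) q := by
    have : captured x (Finset.range N) q - ∑ j, (if l = j then θ else 0) ≤
        captured x (Finset.range (N + t)) q := by
      rw [captured, captured, ← Finset.sum_sub_distrib]
      refine Finset.sum_le_sum fun j _ => ?_
      by_cases hj : l = j
      · subst hj
        rw [if_pos rfl, hpure, mul_div_assoc, div_self (hW _).ne', mul_one, sub_self]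
        exact div_nonneg (binSum_sq_nonneg _ _ _ _) (binSum_nonneg (fun i hi =>
          (hpos i (by have := Finset.mem_range.1 hi; omega)).le) _ _)
      · rw [e1, e2, if_neg hj, if_neg hj, if_neg hj]
        simp
    simpa using this
  have hY : 0 < t * (θ / 4) := by positivity
  -- From now on bin `l` has weight at least `t * (θ / 4)` and `Q ≤ θ W`. Putting `x` there would
  -- cost at most `x θ / W`, and greedy does no worse. By `h4` these costs sum to at most `θ`, the
  -- second one.
  have hD : ∀ u, N + t + u ≤ n →
      binSum (fun i => x i ^ 2) (Finset.range (N + t + u)) q l ≤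
        θ * binSum x (Finset.range (N + t + u)) q l ∧
      t * (θ / 4) ≤ binSum x (Finset.range (N + t + u)) q l ∧
      captured x (Finset.range (N + t)) q -
        (∑ b ∈ Finset.Ico (N + t) (N + t + u), x b) * (θ / (t * (θ / 4))) ≤
          captured x (Finset.range (N + t + u)) q := by
    intro u
    induction u with
    | zero =>
      intro _
      refine ⟨?_, ?_, by simp⟩
      · rw [add_zero, e1, e2, if_pos rfl, if_pos rfl, hpure]
        nlinarith [mul_pos ht (mul_pos hθ hθ)]
      · rw [add_zero, e1, if_pos rfl]
        linarith [hW l]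
    | succ u ih =>
      intro hu
      obtain ⟨j1, j2, j3⟩ := ih (by omega)
      rw [← add_assoc]
      set a := N + t + u with ha
      have hxa := hpos a (by omega)
      have hxθ : x a ≤ θ := by
        rw [← h2 (k - 1) le_rfl (by omega)]
        exact hanti _ _ (by omega) (by omega)
      have hg := hq.binGain_le (a := a) (by omega) l
      have hW0 : 0 < binSum x (Finset.range a) q l := hY.trans_le j2
      refine ⟨?_, ?_, ?_⟩
      · rw [binSum_range_succ, binSum_range_succ]
        split_ifs
        · nlinarith
        · simpa using j1
      · rw [binSum_range_succ]
        split_ifs <;> linarith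
      · rw [captured_range_succ, Finset.sum_Ico_succ_top (by omega), add_mul]
        rw [binGain_eq hW0 hxa] at hg
        have : x a * (binSum (fun i => x i ^ 2) (Finset.range a) q l -
            x a * binSum x (Finset.range a) q l) /
            (binSum x (Finset.range a) q l * (binSum x (Finset.range a) q l + x a)) ≤
            x a * (θ / (t * (θ / 4))) := by
          set W := binSum x (Finset.range a) q l
          calc _ ≤ x a * (θ * W) / (W * W) := by
                apply div_le_div₀ (by positivity) _ (by positivity) (by nlinarith)
                apply mul_le_mul_of_nonneg_left _ hxa.le
                nlinarith
            _ = x a * (θ / W) := by field_simp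
            _ ≤ _ := by
                apply mul_le_mul_of_nonneg_left _ hxa.le
                exact div_le_div_of_nonneg_left hθ.le hY j2
        linarith
  obtain ⟨u, rfl⟩ := Nat.exists_eq_add_of_le hN'
  have hfin := (hD u le_rfl).2.2
  have : (∑ b ∈ Finset.Ico (N + t) (N + t + u), x b) * (θ / (t * (θ / 4))) ≤ θ := by
    rw [mul_div_assoc', div_le_iff₀ hY, mul_comm _ θ]
    apply mul_le_mul_of_nonneg_left _ hθ.le
    refine h4.trans_eq ?_
    push_cast; ring
  linarith

/-! ### Collisions force a loss, for arbitrary positions. -/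

/-- The quotient is the mean of the weights in the bin, weighted by themselves. -/
theorem binSum_sq_div_le {ι κ : Type*} [DecidableEq κ] {w : ι → ℝ} {s : Finset ι} {p : ι → κ}
    {j : κ} {M : ℝ} (hM : 0 ≤ M) (h0 : ∀ i ∈ s, 0 ≤ w i) (h : ∀ i ∈ s, p i = j → w i ≤ M) :
    binSum (fun i => w i ^ 2) s p j / binSum w s p j ≤ M := by
  refine div_le_of_le_mul₀ (binSum_nonneg h0 p j) hM ?_
  rw [binSum, binSum, Finset.mul_sum]
  refine Finset.sum_le_sum fun i hi => ?_
  rw [Finset.mem_filter] at hi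
  nlinarith [h0 i hi.1, h i hi.1 hi.2]

theorem sum_binSum {ι κ : Type*} [DecidableEq κ] [Fintype κ] (f : ι → ℝ) (s : Finset ι)
    (p : ι → κ) : ∑ j, binSum f s p j = ∑ i ∈ s, f i :=
  Finset.sum_fiberwise s p f

theorem sum_image_binSum {ι κ : Type*} [DecidableEq κ] [Fintype κ] (f : ι → ℝ) (s : Finset ι)
    (p : ι → κ) : ∑ j ∈ s.image p, binSum f s p j = ∑ i ∈ s, f i := by
  rw [← sum_binSum f s p]
  refine Finset.sum_subset (Finset.subset_univ _) fun j _ hj => ?_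
  exact binSum_eq_zero f fun b hb hbj => hj (Finset.mem_image.2 ⟨b, hb, hbj⟩)

/-- A bin that contains elements of `H`, of weight at least `μ`, captures at most the weight of
its largest element. -/
theorem binSum_sq_div_le_of_mem {n k : ℕ} {w : Fin n → ℝ} {H : Finset (Fin n)} {μ : ℝ}
    (hw : ∀ i, 0 ≤ w i) (hH : ∀ i ∈ H, μ ≤ w i) (hH' : ∀ i ∉ H, w i ≤ μ) {p : Fin n → Fin k}
    {j : Fin k} (hj : j ∈ H.image p) :
    binSum (fun i => w i ^ 2) Finset.univ p j / binSum w Finset.univ p j ≤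
      binSum w H p j - μ * (binSum (fun _ => 1) H p j - 1) := by
  obtain ⟨i₀, hi₀, hij⟩ := Finset.mem_image.1 hj
  obtain ⟨i, hi, hmax⟩ := Finset.exists_max_image (H.filter fun i => p i = j) w
    ⟨i₀, Finset.mem_filter.2 ⟨hi₀, hij⟩⟩
  have hi' := Finset.mem_filter.1 hi
  have h1 : binSum (fun i => w i ^ 2) Finset.univ p j / binSum w Finset.univ p j ≤ w i := by
    refine binSum_sq_div_le (hw i) (fun i _ => hw i) fun l _ hl => ?_
    by_cases hlH : l ∈ H
    · exact hmax l (Finset.mem_filter.2 ⟨hlH, hl⟩)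
    · exact (hH' l hlH).trans (hH i hi'.1)
  have h2 : w i - μ ≤ ∑ l ∈ H with p l = j, (w l - μ) :=
    Finset.single_le_sum (f := fun l => w l - μ)
      (fun l hl => sub_nonneg.2 (hH l (Finset.mem_filter.1 hl).1)) hi
  rw [Finset.sum_sub_distrib] at h2
  have h3 : ∑ l ∈ H with p l = j, μ = μ * binSum (fun _ => 1) H p j := by
    rw [binSum, Finset.mul_sum]; simp
  rw [h3] at h2
  have h4 : binSum w H p j = ∑ l ∈ H with p l = j, w l := rfl
  linarith

/-- Each bin meeting `H` captures at most one of its elements of `H`, and every other one, of weight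
at least `μ`, is lost. The bins avoiding `H` are left open, to be estimated in two different ways.
-/
theorem captured_le {n k : ℕ} {w : Fin n → ℝ} {H : Finset (Fin n)} {μ : ℝ}
    (hw : ∀ i, 0 ≤ w i) (hH : ∀ i ∈ H, μ ≤ w i) (hH' : ∀ i ∉ H, w i ≤ μ) (p : Fin n → Fin k) :
    captured w Finset.univ p ≤
      ∑ i ∈ H, w i - μ * (H.card - (H.image p).card) + ∑ j ∈ (H.image p)ᶜ,
        binSum (fun i => w i ^ 2) Finset.univ p j / binSum w Finset.univ p j := by
  rw [captured, ← Finset.sum_add_sum_compl (H.image p)]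
  gcongr
  refine (Finset.sum_le_sum fun j hj => binSum_sq_div_le_of_mem hw hH hH' hj).trans_eq ?_
  rw [Finset.sum_sub_distrib, sum_image_binSum, ← Finset.mul_sum, Finset.sum_sub_distrib,
    sum_image_binSum]
  simp

/-- Here the bins avoiding `H` are credited with at most all the weight outside `H`. This suffices
when the collisions in `H` dominate the loss. -/
theorem le_diagCost {n k : ℕ} {w : Fin n → ℝ} {H : Finset (Fin n)} {μ : ℝ}
    (hw : ∀ i, 0 ≤ w i) (hH : ∀ i ∈ H, μ ≤ w i) (hH' : ∀ i ∉ H, w i ≤ μ) (p : Fin n → Fin k) :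
    μ * (H.card - (H.image p).card) ≤ diagCost w Finset.univ p := by
  have h1 := captured_le hw hH hH' p
  have h2 : ∑ j ∈ (H.image p)ᶜ,
      binSum (fun i => w i ^ 2) Finset.univ p j / binSum w Finset.univ p j ≤ ∑ i ∈ Hᶜ, w i := by
    calc _ ≤ ∑ j ∈ (H.image p)ᶜ, binSum w Hᶜ p j := by
          refine Finset.sum_le_sum fun j hj => ?_
          have hj' : ∀ i, p i = j → i ∈ Hᶜ := fun i hi => by
            rw [Finset.mem_compl] at hj ⊢
            exact fun h => hj (Finset.mem_image.2 ⟨i, h, hi⟩)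
          refine binSum_sq_div_le (binSum_nonneg (fun i _ => hw i) p j) (fun i _ => hw i)
            fun i _ hi => ?_
          subst hi
          exact le_binSum (fun i _ => hw i) p (hj' i rfl)
      _ ≤ ∑ j, binSum w Hᶜ p j := Finset.sum_le_sum_of_subset_of_nonneg (Finset.subset_univ _)
          fun j _ _ => binSum_nonneg (fun i _ => hw i) p j
      _ = _ := sum_binSum w Hᶜ p
  rw [diagCost_eq, ← Finset.sum_add_sum_compl H]
  linarith

/-- Here each bin avoiding `H` is credited with at most `θ`. A collision loses `μ` but frees one
more such bin, hence the net `μ - θ`. -/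
theorem le_diagCost_of_le {n k : ℕ} {w : Fin n → ℝ} {H : Finset (Fin n)} {μ θ : ℝ} (hθ : 0 ≤ θ)
    (hθμ : θ ≤ μ) (hw : ∀ i, 0 ≤ w i) (hH : ∀ i ∈ H, μ ≤ w i) (hH' : ∀ i ∉ H, w i ≤ θ)
    (p : Fin n → Fin k) :
    ∑ i ∈ Hᶜ, w i - θ * (k - H.card) + (μ - θ) * (H.card - (H.image p).card) ≤
      diagCost w Finset.univ p := by
  have h1 := captured_le hw hH (fun i hi => (hH' i hi).trans hθμ) p
  have h2 : ∑ j ∈ (H.image p)ᶜ,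
      binSum (fun i => w i ^ 2) Finset.univ p j / binSum w Finset.univ p j ≤
        ∑ j ∈ (H.image p)ᶜ, θ := by
    refine Finset.sum_le_sum fun j hj => binSum_sq_div_le hθ (fun i _ => hw i) fun i _ hi => ?_
    refine hH' i fun h => ?_
    rw [Finset.mem_compl] at hj
    exact hj (Finset.mem_image.2 ⟨i, h, hi⟩)
  rw [Finset.sum_const, nsmul_eq_mul, Finset.card_compl, Fintype.card_fin,
    Nat.cast_sub (by simpa using Finset.card_le_univ (H.image p))] at h2
  rw [diagCost_eq, ← Finset.sum_add_sum_compl H]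
  linarith

/-! ### The expected number of collisions. -/

theorem card_filter_forall_ne {n k : ℕ} (H : Finset (Fin n)) (j : Fin k) :
    (Finset.univ.filter fun p : Fin n → Fin k => ∀ i ∈ H, p i ≠ j).card =
      (k - 1) ^ H.card * k ^ (n - H.card) := by
  have : (Finset.univ.filter fun p : Fin n → Fin k => ∀ i ∈ H, p i ≠ j) =
      Fintype.piFinset fun i => if i ∈ H then Finset.univ.erase j else Finset.univ := by
    ext p
    simp only [Finset.mem_filter, Finset.mem_univ, true_and, Fintype.mem_piFinset]
    refine forall_congr' fun i => ?_
    split_ifs with h <;> simp [h]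
  rw [this, Fintype.card_piFinset]
  have h2 : ∀ i, (if i ∈ H then Finset.univ.erase j else Finset.univ).card =
      if i ∈ H then k - 1 else k := fun i => by
    split_ifs <;> simp
  simp_rw [h2]
  rw [Finset.prod_ite, Finset.prod_const, Finset.prod_const]
  congr 2
  · congr 1; ext; simp
  · have h3 : Finset.univ.filter (· ∉ H) = Hᶜ := by ext; simp
    rw [h3, Finset.card_compl, Fintype.card_fin]

/-- A truncated binomial expansion with `1 / 3` in place of `1 / 2`. The weaker constant absorbs the
negative cubic term: the induction step leaves `h x² (1 - (h - 1) x) / 3 ≥ 0`. -/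
theorem one_sub_pow_ge {x : ℝ} (hx0 : 0 ≤ x) (hx1 : x ≤ 1) (h : ℕ) (hx : ((h : ℝ) - 1) * x ≤ 1) :
    1 - h * x + h * (h - 1) / 3 * x ^ 2 ≤ (1 - x) ^ h := by
  induction h with
  | zero => simp
  | succ h ih =>
    push_cast at hx ⊢
    have h0 : (0 : ℝ) ≤ h := by positivity
    have ih := ih (by nlinarith)
    rw [pow_succ]
    have h1 := mul_le_mul_of_nonneg_right ih (sub_nonneg.2 hx1)
    refine le_trans ?_ h1
    have h2 : 0 ≤ h * x ^ 2 * (1 - (h - 1) * x) := by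
      apply mul_nonneg (by positivity); linarith
    nlinarith

/-- The expected number of collisions of randomly placed elements is large. -/
theorem le_sum_card_sub_card_image {n k : ℕ} (hk : 0 < k) (H : Finset (Fin n))
    (hH : H.card ≤ k + 1) :
    (k : ℝ) ^ n * (H.card * (H.card - 1) / (3 * k)) ≤
      ∑ p : Fin n → Fin k, ((H.card : ℝ) - (H.image p).card) := by
  have hk0 : (0 : ℝ) < k := by exact_mod_cast hk
  have hk1 : (1 : ℝ) ≤ k := by exact_mod_cast hk
  -- Counting missed bins gives an exact expectation, since a fixed bin is missed with probability
  -- `(1 - 1 / k) ^ H.card`.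
  have h1 : ∀ p : Fin n → Fin k, ((H.image p).card : ℝ) =
      k - ∑ j : Fin k, if ∀ i ∈ H, p i ≠ j then 1 else 0 := by
    intro p
    rw [Finset.sum_boole]
    have : (Finset.univ.filter fun j => ∀ i ∈ H, p i ≠ j) = (H.image p)ᶜ := by
      ext j; simp
    rw [this, Finset.card_compl, Fintype.card_fin,
      Nat.cast_sub (by simpa using Finset.card_le_univ (H.image p))]
    ring
  have hn : H.card ≤ n := by simpa using Finset.card_le_univ H
  have h2 : ∑ p : Fin n → Fin k, ∑ j : Fin k, (if ∀ i ∈ H, p i ≠ j then (1 : ℝ) else 0) =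
      k ^ n * (k * (1 - 1 / k) ^ H.card) := by
    rw [Finset.sum_comm]
    simp_rw [Finset.sum_boole, card_filter_forall_ne]
    rw [Finset.sum_const, Finset.card_univ, Fintype.card_fin, nsmul_eq_mul]
    push_cast [Nat.cast_sub hk]
    have h3 : (k : ℝ) ^ n = k ^ H.card * k ^ (n - H.card) := by
      rw [← pow_add, Nat.add_sub_cancel' hn]
    have h4 : (k : ℝ) - 1 = k * (1 - 1 / k) := by field_simp
    rw [h3, h4, mul_pow]
    ring
  simp_rw [h1]
  have h3 : ∑ p : Fin n → Fin k, ((H.card : ℝ) -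
      (k - ∑ j : Fin k, if ∀ i ∈ H, p i ≠ j then 1 else 0)) =
      k ^ n * (H.card - k) + k ^ n * (k * (1 - 1 / k) ^ H.card) := by
    rw [← h2]
    simp_rw [← sub_add]
    rw [Finset.sum_add_distrib, Finset.sum_const]
    simp
  rw [h3, ← mul_add]
  apply mul_le_mul_of_nonneg_left _ (by positivity)
  have hb : (H.card : ℝ) ≤ k + 1 := by exact_mod_cast hH
  have h4 := one_sub_pow_ge (x := 1 / (k : ℝ)) (by positivity)
    (by rw [div_le_one hk0]; exact hk1) H.card (by
      rw [mul_one_div, div_le_one hk0]; linarith)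
  have h5 := mul_le_mul_of_nonneg_left h4 hk0.le
  refine le_trans (le_of_eq ?_) (add_le_add_right h5 _)
  field_simp
  ring

theorem le_expectedRandomCost {n d k : ℕ} (hk : 0 < k) (τ : Fin n → ℝ)
    (A : Matrix (Fin n) (Fin d) ℝ) (H : Finset (Fin n)) (hH : H.card ≤ k + 1) {a b : ℝ}
    (hb : 0 ≤ b)
    (h : ∀ p : Fin n → Fin k,
      a + b * (H.card - (H.image p).card) ≤ sketchCost k (countSketch p τ) A) :
    a + b * (H.card * (H.card - 1) / (3 * k)) ≤ expectedRandomCost k τ A := by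
  have hk0 : (0 : ℝ) < k := by exact_mod_cast hk
  rw [expectedRandomCost, le_div_iff₀ (by positivity)]
  refine le_trans ?_ (Finset.sum_le_sum fun p _ => h p)
  rw [Finset.sum_add_distrib, ← Finset.mul_sum]
  have := mul_le_mul_of_nonneg_left (le_sum_card_sub_card_image hk H hH) hb
  simp only [Finset.sum_const, Finset.card_univ, Fintype.card_pi, Fintype.card_fin,
    Finset.prod_const, nsmul_eq_mul, Nat.cast_pow]
  linarith

/-! ### Random directions are nearly orthogonal. -/

/-- The cone over a spherical cap is contained in a smaller ball. -/
theorem dist_le_of_mem_cone {E : Type*} [NormedAddCommGroup E] [InnerProductSpace ℝ E] {u v : E}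
    (hu : ‖u‖ = 1) (hv : ‖v‖ = 1) {ε r : ℝ} (hε : ε ^ 2 ≤ 1 / 2) (hε0 : 0 ≤ ε)
    (huv : ε ≤ inner ℝ u v) (hr0 : 0 < r) (hr1 : r < 1) :
    dist (r • v) (ε • u) ≤ √(1 - ε ^ 2) := by
  rw [dist_eq_norm]
  apply Real.le_sqrt_of_sq_le
  rw [@norm_sub_sq ℝ, norm_smul, norm_smul, hu, hv, real_inner_smul_left, real_inner_smul_right,
    real_inner_comm, mul_one, mul_one, Real.norm_eq_abs, Real.norm_eq_abs, sq_abs, sq_abs]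
  simp only [RCLike.re_to_real]
  -- The bound `r² - 2 r ε² + ε²` is convex in `r`. At `r = 1` it is `1 - ε²`, and at `r = 0` it is
  -- `ε²`, which is where `ε² ≤ 1 / 2` is needed.
  have h1 : r * (ε * ε) ≤ r * (ε * inner ℝ u v) := by gcongr
  nlinarith [mul_nonneg hr0.le (sub_nonneg.2 hr1.le)]

-- The normalized measure of the cap is the share of the unit ball filled by the cone over it. That
-- cone lies in a ball of radius `√(1 - ε²)`, so the share is at most `(1 - ε²) ^ (d / 2)`.
open scoped Pointwise in
theorem uniformSphere_cap_le {d : ℕ} (hd : 0 < d) {u : EuclideanSpace ℝ (Fin d)} (hu : ‖u‖ = 1)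
    {ε : ℝ} (hε : ε ^ 2 ≤ 1 / 2) (hε0 : 0 ≤ ε) :
    uniformSphere d {v | ε ≤ inner ℝ u (v : EuclideanSpace ℝ (Fin d))} ≤
      ENNReal.ofReal (Real.exp (- (d * ε ^ 2 / 2))) := by
  have : NeZero d := ⟨hd.ne'⟩
  set B := (volume : Measure (EuclideanSpace ℝ (Fin d))) (Metric.ball 0 1) with hB
  have hB0 : B ≠ 0 := (Metric.measure_ball_pos _ _ one_pos).ne'
  have hBt : B ≠ ⊤ := measure_ball_lt_top.ne
  have hmeas : MeasurableSet {v : Metric.sphere (0 : EuclideanSpace ℝ (Fin d)) 1 |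
      ε ≤ inner ℝ u (v : EuclideanSpace ℝ (Fin d))} :=
    (isClosed_le continuous_const (by fun_prop)).measurableSet
  have hsub : Set.Ioo (0 : ℝ) 1 • ((↑) '' {v : Metric.sphere (0 : EuclideanSpace ℝ (Fin d)) 1 |
      ε ≤ inner ℝ u (v : EuclideanSpace ℝ (Fin d))} : Set (EuclideanSpace ℝ (Fin d))) ⊆
      Metric.closedBall (ε • u) (√(1 - ε ^ 2)) := by
    rintro _ ⟨r, hr, _, ⟨v, hv, rfl⟩, rfl⟩
    exact dist_le_of_mem_cone hu (by simp) hε hε0 hv hr.1 hr.2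
  have hpow : √(1 - ε ^ 2) ^ d ≤ Real.exp (- (d * ε ^ 2 / 2)) := by
    have h1 : √(1 - ε ^ 2) ≤ Real.exp (- (ε ^ 2 / 2)) := by
      apply Real.sqrt_le_iff.2 ⟨(Real.exp_pos _).le, _⟩
      rw [← Real.exp_nat_mul]
      have := Real.add_one_le_exp (- ε ^ 2)
      refine le_trans (by linarith) (this.trans_eq (by congr 1; push_cast; ring))
    calc √(1 - ε ^ 2) ^ d ≤ Real.exp (- (ε ^ 2 / 2)) ^ d :=
          pow_le_pow_left₀ (Real.sqrt_nonneg _) h1 d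
      _ = _ := by rw [← Real.exp_nat_mul]; congr 1; ring
  rw [uniformSphere, Measure.smul_apply, smul_eq_mul, Measure.toSphere_apply_univ,
    Measure.toSphere_apply' _ hmeas, ← hB]
  have hvol := (measure_mono (μ := volume) hsub).trans_eq
    (Measure.addHaar_closedBall volume (ε • u) (Real.sqrt_nonneg _))
  rw [finrank_euclideanSpace_fin, ← hB] at hvol
  rw [finrank_euclideanSpace_fin]
  have hd0 : (d : ENNReal) ≠ 0 := by exact_mod_cast hd.ne'
  calc ((d : ENNReal) * B)⁻¹ * (d * volume (Set.Ioo (0 : ℝ) 1 • ((↑) ''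
        {v : Metric.sphere (0 : EuclideanSpace ℝ (Fin d)) 1 |
          ε ≤ inner ℝ u (v : EuclideanSpace ℝ (Fin d))} : Set (EuclideanSpace ℝ (Fin d)))))
      ≤ (d * B)⁻¹ * (d * (ENNReal.ofReal (√(1 - ε ^ 2) ^ d) * B)) := by gcongr
    _ = ENNReal.ofReal (√(1 - ε ^ 2) ^ d) * ((d * B)⁻¹ * (d * B)) := by ring
    _ = ENNReal.ofReal (√(1 - ε ^ 2) ^ d) := by
        rw [ENNReal.inv_mul_cancel (mul_ne_zero hd0 hB0)
          (ENNReal.mul_ne_top (ENNReal.natCast_ne_top d) hBt), mul_one]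
    _ ≤ _ := ENNReal.ofReal_le_ofReal hpow

theorem uniformSphere_abs_inner_le {d : ℕ} (hd : 0 < d) {u : EuclideanSpace ℝ (Fin d)}
    (hu : ‖u‖ = 1) {ε : ℝ} (hε : ε ^ 2 ≤ 1 / 2) (hε0 : 0 ≤ ε) :
    uniformSphere d {v | ε ≤ |inner ℝ u (v : EuclideanSpace ℝ (Fin d))|} ≤
      2 * ENNReal.ofReal (Real.exp (- (d * ε ^ 2 / 2))) := by
  have : {v : Metric.sphere (0 : EuclideanSpace ℝ (Fin d)) 1 |
      ε ≤ |inner ℝ u (v : EuclideanSpace ℝ (Fin d))|} ⊆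
      {v | ε ≤ inner ℝ u (v : EuclideanSpace ℝ (Fin d))} ∪
        {v | ε ≤ inner ℝ (-u) (v : EuclideanSpace ℝ (Fin d))} := by
    intro v hv
    simpa [le_abs, inner_neg_left] using hv
  refine (measure_mono this).trans ((measure_union_le _ _).trans ?_)
  rw [two_mul]
  exact add_le_add (uniformSphere_cap_le hd hu hε hε0)
    (uniformSphere_cap_le hd (by simpa using hu) hε hε0)

theorem pi_pair_eq_prod {ι α : Type*} [Fintype ι] [MeasurableSpace α] (μ : Measure α)
    [IsProbabilityMeasure μ] {i l : ι} (hil : i ≠ l) {S : Set (α × α)} (hS : MeasurableSet S) :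
    (Measure.pi fun _ : ι => μ) {V | (V i, V l) ∈ S} = (μ.prod μ) S := by
  have h1 : ProbabilityTheory.IndepFun (fun V : ι → α => V i) (fun V => V l)
      (Measure.pi fun _ : ι => μ) :=
    (ProbabilityTheory.iIndepFun_pi (X := fun _ : ι => (id : α → α))
      (fun _ => aemeasurable_id)).indepFun hil
  have h2 := (ProbabilityTheory.indepFun_iff_map_prod_eq_prod_map_map
    (measurable_pi_apply i).aemeasurable (measurable_pi_apply l).aemeasurable).1 h1
  have h3 : ∀ m : ι, Measure.map (fun V : ι → α => V m) (Measure.pi fun _ : ι => μ) = μ :=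
    fun m => (measurePreserving_eval (fun _ : ι => μ) m).map_eq
  rw [h3, h3] at h2
  rw [← h2, Measure.map_apply (by fun_prop) hS]
  rfl

/-- Fubini for two independent coordinates: a bound uniform in the first one carries over to the
pair. -/
theorem pi_pi_pair_le {ι' ι α : Type*} [Fintype ι'] [Fintype ι] [MeasurableSpace α]
    (μ : Measure α) [IsProbabilityMeasure μ] (t : ι') {i l : ι} (hil : i ≠ l) {S : Set (α × α)}
    (hS : MeasurableSet S) {c : ENNReal} (hc : ∀ x, μ (Prod.mk x ⁻¹' S) ≤ c) :
    (Measure.pi fun _ : ι' => Measure.pi fun _ : ι => μ) {V | (V t i, V t l) ∈ S} ≤ c := by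
  have hS' : MeasurableSet {v : ι → α | (v i, v l) ∈ S} :=
    ((measurable_pi_apply i).prodMk (measurable_pi_apply l)) hS
  have h1 := (measurePreserving_eval (fun _ : ι' => Measure.pi fun _ : ι => μ) t).measure_preimage
    hS'.nullMeasurableSet
  rw [pi_pair_eq_prod _ hil hS, Measure.prod_apply hS] at h1
  refine (le_of_eq h1).trans ((lintegral_mono hc).trans ?_)
  simp

theorem spikedDirections_pair_le {N n d : ℕ} (hd : 0 < d) (t : Fin N) {i l : Fin n} (hil : i ≠ l)
    {ε : ℝ} (hε : ε ^ 2 ≤ 1 / 2) (hε0 : 0 ≤ ε) :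
    spikedDirections N n d {V | ε ≤ |inner ℝ (V t i : EuclideanSpace ℝ (Fin d))
      (V t l : EuclideanSpace ℝ (Fin d))|} ≤
      2 * ENNReal.ofReal (Real.exp (- (d * ε ^ 2 / 2))) := by
  have := isProbabilityMeasure_uniformSphere d hd
  have hS : MeasurableSet {x : Metric.sphere (0 : EuclideanSpace ℝ (Fin d)) 1 ×
      Metric.sphere (0 : EuclideanSpace ℝ (Fin d)) 1 |
      ε ≤ |inner ℝ (x.1 : EuclideanSpace ℝ (Fin d)) (x.2 : EuclideanSpace ℝ (Fin d))|} :=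
    (isClosed_le continuous_const (by fun_prop)).measurableSet
  exact pi_pi_pair_le (uniformSphere d) t hil hS fun x =>
    uniformSphere_abs_inner_le hd (norm_eq_of_mem_sphere x) hε hε0

theorem spikedDirections_le {N n d : ℕ} (hd : 0 < d) {ε : ℝ} (hε : ε ^ 2 ≤ 1 / 2) (hε0 : 0 ≤ ε) :
    spikedDirections N n d {V | ∃ t i l, i ≠ l ∧ ε ≤ |inner ℝ (V t i : EuclideanSpace ℝ (Fin d))
      (V t l : EuclideanSpace ℝ (Fin d))|} ≤
      ENNReal.ofReal (N * (2 * n ^ 2 * Real.exp (- (d * ε ^ 2 / 2)))) := by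
  have hsub : {V : Fin N → Fin n → Metric.sphere (0 : EuclideanSpace ℝ (Fin d)) 1 |
      ∃ t i l, i ≠ l ∧ ε ≤ |inner ℝ (V t i : EuclideanSpace ℝ (Fin d))
      (V t l : EuclideanSpace ℝ (Fin d))|} ⊆
      ⋃ x ∈ (Finset.univ : Finset (Fin N × Fin n × Fin n)).filter fun x => x.2.1 ≠ x.2.2,
        {V | ε ≤ |inner ℝ (V x.1 x.2.1 : EuclideanSpace ℝ (Fin d))
          (V x.1 x.2.2 : EuclideanSpace ℝ (Fin d))|} := by
    rintro V ⟨t, i, l, hil, h⟩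
    simp only [Set.mem_iUnion]
    exact ⟨(t, i, l), by simpa using hil, h⟩
  refine (measure_mono hsub).trans ((measure_biUnion_finset_le _ _).trans ?_)
  refine (Finset.sum_le_sum fun x hx => spikedDirections_pair_le hd x.1
    (Finset.mem_filter.1 hx).2 hε hε0).trans ?_
  refine (Finset.sum_le_sum_of_subset (Finset.filter_subset _ _)).trans ?_
  rw [Finset.sum_const, Finset.card_univ, nsmul_eq_mul]
  refine le_of_eq ?_
  rw [ENNReal.ofReal_mul (by positivity), ENNReal.ofReal_mul (by positivity),
    ENNReal.ofReal_mul (by positivity), ENNReal.ofReal_pow (by positivity)]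
  simp only [Fintype.card_prod, Fintype.card_fin, Nat.cast_mul, ENNReal.ofReal_natCast,
    ENNReal.ofReal_ofNat]
  ring

/-! ### The Gram matrix of the spiked model. -/

theorem spikedMatrix_sq_sum {n d : ℕ} (R : Finset (Fin n)) (ℓ : ℝ)
    (v : Fin n → Metric.sphere (0 : EuclideanSpace ℝ (Fin d)) 1) (z : Fin n → ℝ) :
    ∑ j, (∑ i, z i * spikedMatrix R ℓ v i j) ^ 2 =
      ∑ i, ∑ l, (z i * if i ∈ R then ℓ else 1) * (z l * if l ∈ R then ℓ else 1) *
        inner ℝ (v i : EuclideanSpace ℝ (Fin d)) (v l : EuclideanSpace ℝ (Fin d)) := by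
  simp_rw [sq, Finset.sum_mul_sum]
  rw [Finset.sum_comm]
  refine Finset.sum_congr rfl fun i _ => ?_
  rw [Finset.sum_comm]
  refine Finset.sum_congr rfl fun l _ => ?_
  rw [PiLp.inner_apply, Finset.mul_sum]
  refine Finset.sum_congr rfl fun j _ => ?_
  simp only [spikedMatrix, Matrix.of_apply, RCLike.inner_apply, conj_trivial]
  ring

/-- After absorbing `ℓ` into the coefficients `y`, the off-diagonal part is at most `δ (∑ |y i|)²`,
and Cauchy–Schwarz gives the factor `n`. The relative error is therefore independent of `ℓ`. -/
theorem spikedMatrix_nearOrthogonal {n d : ℕ} (R : Finset (Fin n)) (ℓ : ℝ)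
    (v : Fin n → Metric.sphere (0 : EuclideanSpace ℝ (Fin d)) 1) {δ : ℝ}
    (hδ0 : 0 ≤ δ) (hδ : ∀ i l, i ≠ l →
      |inner ℝ (v i : EuclideanSpace ℝ (Fin d)) (v l : EuclideanSpace ℝ (Fin d))| ≤ δ) :
    NearOrthogonal (n * δ) (fun i => if i ∈ R then ℓ ^ 2 else 1) (spikedMatrix R ℓ v) := by
  intro z
  set y : Fin n → ℝ := fun i => z i * if i ∈ R then ℓ else 1 with hy
  have h1 : ∑ i, z i ^ 2 * (if i ∈ R then ℓ ^ 2 else 1) = ∑ i, y i ^ 2 := by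
    refine Finset.sum_congr rfl fun i _ => ?_
    simp only [hy]
    split_ifs <;> ring
  have h2 : ∑ i, y i ^ 2 = ∑ i, ∑ l, if i = l then y i * y l else 0 := by
    simp [sq]
  rw [spikedMatrix_sq_sum, h1]
  calc |∑ i, ∑ l, y i * y l * inner ℝ (v i : EuclideanSpace ℝ (Fin d))
          (v l : EuclideanSpace ℝ (Fin d)) - ∑ i, y i ^ 2|
      = |∑ i, ∑ l, (y i * y l * inner ℝ (v i : EuclideanSpace ℝ (Fin d))
          (v l : EuclideanSpace ℝ (Fin d)) - if i = l then y i * y l else 0)| := by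
        rw [h2]; simp_rw [Finset.sum_sub_distrib]
    _ ≤ ∑ i, ∑ l, δ * (|y i| * |y l|) := by
        refine (Finset.abs_sum_le_sum_abs _ _).trans (Finset.sum_le_sum fun i _ => ?_)
        refine (Finset.abs_sum_le_sum_abs _ _).trans (Finset.sum_le_sum fun l _ => ?_)
        split_ifs with h
        · subst h
          have : inner ℝ (v i : EuclideanSpace ℝ (Fin d)) (v i : EuclideanSpace ℝ (Fin d)) =
              (1 : ℝ) := by
            rw [real_inner_self_eq_norm_sq, norm_eq_of_mem_sphere]; norm_num
          rw [this, mul_one, sub_self, abs_zero]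
          positivity
        · rw [sub_zero, abs_mul, abs_mul, mul_comm]
          exact mul_le_mul_of_nonneg_right (hδ i l h) (by positivity)
    _ = δ * (∑ i, |y i|) ^ 2 := by
        rw [sq, Finset.sum_mul_sum]
        simp_rw [Finset.mul_sum]
    _ ≤ δ * (n * ∑ i, y i ^ 2) := by
        gcongr
        have := sq_sum_le_card_mul_sum_sq (s := Finset.univ) (f := fun i => |y i|)
        simpa using this
    _ = _ := by ring

/-! ### Matching the processing order with the weight classes. -/

theorem exists_nat_extension {n : ℕ} {α : Type*} [Nonempty α] (f : Fin n → α) :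
    ∃ x : ℕ → α, ∀ b : Fin n, x b = f b := by
  classical
  exact ⟨fun b => if h : b < n then f ⟨b, h⟩ else Classical.arbitrary α, fun b => by simp⟩

/-- In an order of non-increasing weights, a set of largest weights comes first. -/
theorem mem_iff_lt_card {n : ℕ} {π : Equiv.Perm (Fin n)} {w : Fin n → ℝ}
    (hw : ∀ a b, a ≤ b → w (π b) ≤ w (π a)) {H : Finset (Fin n)}
    (hH : ∀ i ∈ H, ∀ i' ∉ H, w i' < w i) (a : Fin n) : π a ∈ H ↔ (a : ℕ) < H.card := by
  have hcard : H.card = (H.map π.symm.toEmbedding).card := (Finset.card_map _).symm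
  have hmem : ∀ b, b ∈ H.map π.symm.toEmbedding ↔ π b ∈ H := fun b => by
    simp
  have hdown : ∀ a b, a ≤ b → π b ∈ H → π a ∈ H := fun a b hab hb => by
    by_contra ha
    exact (hH _ hb _ ha).not_ge (hw a b hab)
  rw [hcard]
  constructor
  · intro h
    have : Finset.Iic a ⊆ H.map π.symm.toEmbedding := fun b hb =>
      (hmem b).2 (hdown b a (Finset.mem_Iic.1 hb) h)
    have := Finset.card_le_card this
    rw [Fin.card_Iic] at this
    omega
  · intro h
    by_contra ha
    have : H.map π.symm.toEmbedding ⊆ Finset.Iio a := fun b hb => Finset.mem_Iio.2 (by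
      by_contra hab
      exact ha (hdown a b (not_lt.1 hab) ((hmem b).1 hb)))
    have := Finset.card_le_card this
    rw [Fin.card_Iio] at this
    omega

theorem diagCost_univ_eq {n k : ℕ} (π : Equiv.Perm (Fin n)) (w : Fin n → ℝ)
    (p : Fin n → Fin k) (x : ℕ → ℝ) (q : ℕ → Fin k) (hx : ∀ b : Fin n, x b = w (π b))
    (hq : ∀ b : Fin n, q b = p (π b)) :
    diagCost w Finset.univ p =
      ∑ b ∈ Finset.range n, x b - captured x (Finset.range n) q := by
  rw [diagCost_eq, ← captured_perm_eq π w p x q hx hq le_rfl, sum_perm_eq π w x hx]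
  simp

theorem sketchCost_sign_bounds {n d k : ℕ} {ε : ℝ} (hε : ε ≤ 1) {w : Fin n → ℝ}
    (hw : ∀ i, 0 < w i) {A : Matrix (Fin n) (Fin d) ℝ} (hA : NearOrthogonal ε w A)
    (p : Fin n → Fin k) {τ : Fin n → ℝ} (hτ : IsSign τ) :
    (1 - ε) * diagCost w Finset.univ p ≤ sketchCost k (countSketch p τ) A ∧
      sketchCost k (countSketch p τ) A ≤ (1 + ε) * diagCost w Finset.univ p :=
  sketchCost_bounds hε hw hA Finset.univ p τ (fun i _ => hτ.sq_eq_one i) (by simp)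

/-! ### The spiked covariance model. -/

theorem spiked_numeric {k s : ℕ} {α : ℝ} (hs : 1 ≤ s) (hsα : (s : ℝ) = α * ((k : ℝ) - 1))
    (hα : 7 / 10 < α) (hα1 : α < 1) :
    s + 2 ≤ k ∧ 8 * (k : ℝ) ^ 2 ≤ 25 * ((k - 1) * (s - 1)) := by
  have hs' : (1 : ℝ) ≤ s := by exact_mod_cast hs
  have hk1 : (1 : ℝ) < k := by
    by_contra h
    nlinarith
  have h1 : (s : ℝ) < k - 1 := by nlinarith
  have h2 : 7 * ((k : ℝ) - 1) < 10 * s := by nlinarith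
  have h1' : s + 1 < k := by
    have : (s : ℝ) + 1 < k := by linarith
    exact_mod_cast this
  have h2' : 7 * k < 10 * s + 7 := by
    have : 7 * (k : ℝ) < 10 * s + 7 := by linarith
    exact_mod_cast this
  refine ⟨by omega, ?_⟩
  have hk5 : 5 ≤ k := by omega
  -- Equality holds at `k = 5`, `s = 3`. The estimate from `7 k ≤ 10 s + 6` is too weak there and
  -- works from `k = 6` on.
  rcases hk5.eq_or_lt with rfl | hk6
  · have : s = 3 := by omega
    subst this
    norm_num
  · have h3 : 7 * (k : ℝ) - 6 ≤ 10 * s := by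
      have : 7 * k ≤ 10 * s + 6 := by omega
      have : 7 * (k : ℝ) ≤ 10 * s + 6 := by exact_mod_cast this
      linarith
    have h6 : (6 : ℝ) ≤ k := by exact_mod_cast hk6
    nlinarith

/-- The greedy algorithm beats random positions on nearly orthogonal rows of which `s` are long. -/
theorem greedyBeatsRandom_of_spiked {n d k s N : ℕ} {α ℓ ε : ℝ} {R : Finset (Fin n)}
    (hR : R.card = s) (hs : 1 ≤ s) (hsα : (s : ℝ) = α * ((k : ℝ) - 1)) (hα : 7 / 10 < α)
    (hα1 : α < 1) (hℓn : (4 * Real.exp 1 + 1) * n / (α * k) ≤ ℓ ^ 2)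
    {A : Fin N → Matrix (Fin n) (Fin d) ℝ}
    (hnorm : ∀ t i, ∑ j, A t i j ^ 2 = if i ∈ R then ℓ ^ 2 else 1)
    (hε0 : 0 ≤ ε) (hε : ε * n ≤ 1 / 16)
    (hA : ∀ t, NearOrthogonal ε (fun i => if i ∈ R then ℓ ^ 2 else 1) (A t)) :
    GreedyBeatsRandom k (1 / 20) A := by
  obtain ⟨hsk, hnum⟩ := spiked_numeric hs hsα hα hα1
  have hsn : s ≤ n := by simpa [hR] using Finset.card_le_univ R
  have hs' : (1 : ℝ) ≤ s := by exact_mod_cast hs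
  have hsn' : (s : ℝ) ≤ n := by exact_mod_cast hsn
  have hsk' : (s : ℝ) + 2 ≤ k := by exact_mod_cast hsk
  have hk0 : (0 : ℝ) < k := by linarith
  have hε1 : ε ≤ 1 / 16 := by nlinarith
  -- A rational lower bound sharp enough for `η = 1 / 20`.
  have hexp : 59 / 5 ≤ 4 * Real.exp 1 + 1 := by
    have := Real.exp_one_gt_d9
    linarith
  have hℓ2 : 59 / 5 * n * (k - 1) ≤ ℓ ^ 2 * (s * k) := by
    rw [div_le_iff₀ (by positivity)] at hℓn
    have h1 : 59 / 5 * n ≤ ℓ ^ 2 * (α * k) := le_trans (by gcongr) hℓn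
    calc 59 / 5 * n * (k - 1) ≤ ℓ ^ 2 * (α * k) * (k - 1) := by
          apply mul_le_mul_of_nonneg_right h1; linarith
      _ = _ := by rw [hsα]; ring
  have hμ : 3 ≤ ℓ ^ 2 := by
    by_contra h
    have h1 : ℓ ^ 2 * (s * k) ≤ 3 * (s * k) := by
      apply mul_le_mul_of_nonneg_right (by linarith); positivity
    nlinarith
  set w : Fin n → ℝ := fun i => if i ∈ R then ℓ ^ 2 else 1 with hw
  have hwR : ∀ i ∈ R, w i = ℓ ^ 2 := fun i hi => if_pos hi
  have hwR' : ∀ i ∉ R, w i = 1 := fun i hi => if_neg hi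
  have hwpos : ∀ i, 0 < w i := fun i => by
    by_cases hi : i ∈ R
    · rw [hwR i hi]; linarith
    · rw [hwR' i hi]; norm_num
  intro T π σ p hT hσ hp t τ τ' hτ hτ'
  have hanti : ∀ a b, a ≤ b → w (π b) ≤ w (π a) := fun a b hab => by
    obtain ⟨t₀, ht₀⟩ := hT
    have := hp.1 t₀ ht₀ a b hab
    rwa [hnorm, hnorm] at this
  have hfirst := mem_iff_lt_card hanti (H := R) fun i hi i' hi' => by
    rw [hwR i hi, hwR' i' hi']; linarith
  have : Nonempty (Fin k) := ⟨⟨0, by omega⟩⟩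
  obtain ⟨x, hx⟩ := exists_nat_extension fun b => w (π b)
  obtain ⟨q, hq⟩ := exists_nat_extension fun b => p (π b)
  have hseq := isGreedySeq_of_isGreedyRun (by linarith) hwpos hT (fun t _ => hA t) hσ hp x q hx hq
  have hloss := hseq.loss_le_of_heavy (s := s) (μ := ℓ ^ 2) (by omega) hsn
    (fun b hb => by
      rw [hx ⟨b, by omega⟩]
      exact hwR _ ((hfirst _).2 (by rw [hR]; exact hb)))
    (fun b hb hbn => by
      rw [hx ⟨b, hbn⟩]
      refine hwR' _ fun h => ?_
      have := (hfirst _).1 h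
      rw [hR] at this
      exact absurd hb (not_le.2 this))
    hμ hε0 hε
  rw [← diagCost_univ_eq π w p x q hx hq] at hloss
  have hup := (sketchCost_sign_bounds (by linarith) hwpos (hA t) p hτ).2
  have hlow := le_expectedRandomCost (n := n) (d := d) (k := k) (by omega) τ' (A t) R (by omega)
    (a := 0) (b := (1 - ε) * ℓ ^ 2) (mul_nonneg (by linarith) (by positivity)) fun p' => by
      have h1 := (sketchCost_sign_bounds (by linarith) hwpos (hA t) p' hτ').1
      refine le_trans (le_of_eq_of_le ?_ (mul_le_mul_of_nonneg_left (le_diagCost (H := R)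
        (μ := ℓ ^ 2) (fun i => (hwpos i).le) (fun i hi => (hwR i hi).ge)
        (fun i hi => by rw [hwR' i hi]; linarith) p') (by linarith : 0 ≤ 1 - ε))) h1
      ring
  rw [hR, zero_add] at hlow
  have hmain : 15 / 16 * (59 / 5 * n * 8 / 75) ≤ (1 - ε) * ℓ ^ 2 * (s * (s - 1) / (3 * k)) := by
    have h1 : 59 / 5 * n * 8 / 75 ≤ ℓ ^ 2 * (s * (s - 1) / (3 * k)) := by
      have h2 : 59 / 5 * n * (8 * (k : ℝ) ^ 2) ≤ 25 * (ℓ ^ 2 * (s * k)) * (s - 1) := by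
        calc 59 / 5 * n * (8 * (k : ℝ) ^ 2) ≤ 59 / 5 * n * (25 * ((k - 1) * (s - 1))) := by
              gcongr
          _ = 25 * (59 / 5 * n * (k - 1)) * (s - 1) := by ring
          _ ≤ _ := by
              apply mul_le_mul_of_nonneg_right _ (by linarith)
              linarith
      have h3 : ℓ ^ 2 * (s * (s - 1) / (3 * k)) =
          25 * (ℓ ^ 2 * (s * k)) * (s - 1) / (75 * k ^ 2) := by
        field_simp
        ring
      rw [h3, le_div_iff₀ (by positivity)]
      linarith
    have h4 : (0 : ℝ) ≤ 59 / 5 * n * 8 / 75 := by positivity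
    calc 15 / 16 * (59 / 5 * n * 8 / 75) ≤ (1 - ε) * (59 / 5 * n * 8 / 75) := by
          apply mul_le_mul_of_nonneg_right _ h4; linarith
      _ ≤ (1 - ε) * (ℓ ^ 2 * (s * (s - 1) / (3 * k))) := by
          apply mul_le_mul_of_nonneg_left h1; linarith
      _ = _ := by ring
  have hcost : sketchCost k (countSketch p τ) (A t) ≤ 17 / 16 * n := by
    refine hup.trans ?_
    have h1 : (1 + ε) * diagCost w Finset.univ p ≤ (1 + ε) * (n - s) :=
      mul_le_mul_of_nonneg_left hloss (by linarith)
    nlinarith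
  -- Numerically, `17 / 16 ≤ (19 / 20) * (15 / 16) * (472 / 375)`.
  linarith

theorem sum_spikedMatrix_sq {n d : ℕ} (R : Finset (Fin n)) (ℓ : ℝ)
    (v : Fin n → Metric.sphere (0 : EuclideanSpace ℝ (Fin d)) 1) (i : Fin n) :
    ∑ j, spikedMatrix R ℓ v i j ^ 2 = if i ∈ R then ℓ ^ 2 else 1 := by
  have h1 : ∑ j, (v i : EuclideanSpace ℝ (Fin d)) j ^ 2 = 1 := by
    rw [← EuclideanSpace.real_norm_sq_eq, norm_eq_of_mem_sphere]; norm_num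
  simp only [spikedMatrix, Matrix.of_apply, mul_pow]
  rw [← Finset.mul_sum, h1, mul_one]
  split_ifs <;> norm_num

/-- From `y ^ (c + 2) / (c + 2)! ≤ exp y`: the exponent `c + 2` pays for `n ^ c` and for the `n ^ 2`
of the union bound over pairs. -/
theorem two_mul_sq_mul_exp_neg_le {n c : ℕ} (hn : 1 ≤ n) {y : ℝ}
    (hy : 2 * ((c + 2).factorial : ℝ) * n ^ 2 ≤ y) :
    2 * (n : ℝ) ^ 2 * Real.exp (-y) ≤ 1 / n ^ c := by
  have hn' : (1 : ℝ) ≤ n := by exact_mod_cast hn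
  have hn0 : (0 : ℝ) < n := by linarith
  have hf : (1 : ℝ) ≤ (c + 2).factorial := by exact_mod_cast (c + 2).factorial_pos
  set f : ℝ := ((c + 2).factorial : ℝ) with hfdef
  have hy0 : 0 ≤ y := le_trans (by positivity) hy
  have h1 : 2 * (n : ℝ) ^ (c + 2) ≤ Real.exp y := by
    refine le_trans ?_ (Real.pow_div_factorial_le_exp y hy0 (c + 2))
    rw [le_div_iff₀ (by positivity)]
    calc 2 * (n : ℝ) ^ (c + 2) * (c + 2).factorial
        = (2 * f) ^ 1 * n ^ (c + 2) := by rw [hfdef]; ring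
      _ ≤ (2 * f) ^ (c + 2) * (n ^ 2) ^ (c + 2) := by
          gcongr
          · linarith
          · omega
          · nlinarith
      _ = (2 * f * n ^ 2) ^ (c + 2) := by rw [← mul_pow]
      _ ≤ y ^ (c + 2) := by gcongr
  rw [Real.exp_neg, le_div_iff₀ (by positivity), mul_right_comm, ← div_eq_mul_inv,
    div_le_one (Real.exp_pos _)]
  refine le_trans (le_of_eq ?_) h1
  ring

theorem spikedDirections_not_greedyBeatsRandom_le (c : ℕ) {n d k s N : ℕ} {α ℓ : ℝ}
    {R : Finset (Fin n)} (hR : R.card = s) (hs : 1 ≤ s) (hsα : (s : ℝ) = α * ((k : ℝ) - 1))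
    (hα : 7 / 10 < α) (hα1 : α < 1) (hℓ : 1 < ℓ)
    (hℓn : (4 * Real.exp 1 + 1) * n / (α * k) ≤ ℓ ^ 2)
    (hd : 512 * (2 * ((c + 2).factorial : ℝ)) * (n : ℝ) ^ 6 * ℓ ^ 2 ≤ d) :
    spikedDirections N n d
        {V | ¬ GreedyBeatsRandom k (1 / 20) (fun t => spikedMatrix R ℓ (V t))} ≤
      ENNReal.ofReal ((N : ℝ) / (n : ℝ) ^ c) := by
  have hn : 1 ≤ n := hs.trans (by simpa [hR] using Finset.card_le_univ R)
  have hn' : (1 : ℝ) ≤ n := by exact_mod_cast hn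
  have hn0 : (0 : ℝ) < n := by linarith
  have hf : (1 : ℝ) ≤ (c + 2).factorial := by exact_mod_cast (c + 2).factorial_pos
  have hd0 : 0 < d := by
    have : (0 : ℝ) < d := lt_of_lt_of_le (by positivity) hd
    exact_mod_cast this
  -- Chosen so that `ε = n * δ` satisfies `ε * n = 1 / 16`. The tail exponent `d δ² / 2` is then `d
  -- / (512 n ^ 4)`.
  set δ : ℝ := 1 / (16 * n ^ 2) with hδ
  have hδ0 : 0 ≤ δ := by positivity
  have hδ1 : δ ≤ 1 / 16 := by
    apply one_div_le_one_div_of_le (by norm_num)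
    nlinarith
  have hsub : {V : Fin N → Fin n → Metric.sphere (0 : EuclideanSpace ℝ (Fin d)) 1 |
      ¬ GreedyBeatsRandom k (1 / 20) (fun t => spikedMatrix R ℓ (V t))} ⊆
      {V | ∃ t i l, i ≠ l ∧ δ ≤ |inner ℝ (V t i : EuclideanSpace ℝ (Fin d))
        (V t l : EuclideanSpace ℝ (Fin d))|} := by
    intro V hV
    by_contra hcon
    simp only [Set.mem_ofPred_eq, not_exists, not_and, not_le] at hcon
    refine hV (greedyBeatsRandom_of_spiked (ε := n * δ) hR hs hsα hα hα1 hℓn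
      (fun t i => sum_spikedMatrix_sq R ℓ (V t) i) (by positivity) ?_
      (fun t => spikedMatrix_nearOrthogonal R ℓ (V t) hδ0 fun i l hil => (hcon t i l hil).le))
    rw [hδ]
    field_simp
    norm_num
  refine (measure_mono hsub).trans ((spikedDirections_le hd0 (by nlinarith) hδ0).trans ?_)
  apply ENNReal.ofReal_le_ofReal
  rw [div_eq_mul_one_div (N : ℝ)]
  apply mul_le_mul_of_nonneg_left _ (by positivity)
  apply two_mul_sq_mul_exp_neg_le hn
  have h1 : (d : ℝ) * δ ^ 2 / 2 = d / (512 * n ^ 4) := by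
    rw [hδ]
    field_simp
    norm_num
  rw [h1, le_div_iff₀ (by positivity)]
  refine le_trans ?_ hd
  have hℓ2 : 1 ≤ ℓ ^ 2 := by nlinarith
  calc 2 * ((c + 2).factorial : ℝ) * n ^ 2 * (512 * n ^ 4)
      = 512 * (2 * ((c + 2).factorial : ℝ)) * (n : ℝ) ^ 6 * 1 := by ring
    _ ≤ _ := by gcongr

/-! ### Zipfian squared row norms. -/

theorem IsZipfMatrix.nearOrthogonal {n d : ℕ} {lev : Fin n → ℕ} {A : Matrix (Fin n) (Fin d) ℝ}
    (hA : IsZipfMatrix lev A) :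
    NearOrthogonal 0 (fun i => (n : ℝ) ^ 2 / 2 ^ (2 * lev i)) A := by
  intro z
  have h : ∑ j, (∑ i, z i * A i j) ^ 2 = ∑ i, z i ^ 2 * ((n : ℝ) ^ 2 / 2 ^ (2 * lev i)) := by
    simp_rw [sq (∑ i, z i * A i _), Finset.sum_mul_sum]
    rw [Finset.sum_comm]
    refine Finset.sum_congr rfl fun i _ => ?_
    rw [Finset.sum_comm, Finset.sum_eq_single i]
    · rw [← hA.2 i, Finset.mul_sum]
      exact Finset.sum_congr rfl fun j _ => by ring
    · intro l _ hl
      calc ∑ j, z i * A i j * (z l * A l j) = z i * z l * ∑ j, A i j * A l j := by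
            rw [Finset.mul_sum]
            exact Finset.sum_congr rfl fun j _ => by ring
        _ = 0 := by rw [hA.1 i l hl.symm, mul_zero]
    · simp
  rw [h]
  simp

theorem IsZipfLevels.card_lt {n h : ℕ} {lev : Fin n → ℕ} (hl : IsZipfLevels h lev) {m : ℕ}
    (hm : 1 ≤ m) (hmh : m ≤ h + 1) :
    (Finset.univ.filter fun i => lev i < m).card + 4 = 2 ^ (m + 1) := by
  induction m, hm using Nat.le_induction with
  | base =>
    have : (Finset.univ.filter fun i => lev i < 1) = ∅ :=
      Finset.filter_eq_empty_iff.2 fun i _ => not_lt.2 (hl.1 i).1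
    rw [this]
    rfl
  | succ m hm ih =>
    have h1 : (Finset.univ.filter fun i => lev i < m + 1) =
        (Finset.univ.filter fun i => lev i < m) ∪ (Finset.univ.filter fun i => lev i = m) := by
      ext i
      simp only [Finset.mem_filter, Finset.mem_univ, true_and, Finset.mem_union]
      omega
    rw [h1, Finset.card_union_of_disjoint, hl.2 m hm (by omega)]
    · have := ih (by omega)
      rw [pow_succ 2 (m + 1)]
      omega
    · rw [Finset.disjoint_filter]
      intro i _ h
      omega

/-- Level `i` has total weight `2 n² / 2 ^ i`, a geometric series. The induction runs downwards from
the empty levels above `h`. -/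
theorem IsZipfLevels.sum_le {n h : ℕ} {lev : Fin n → ℕ} (hl : IsZipfLevels h lev) {m : ℕ}
    (hm : 1 ≤ m) :
    ∑ i with m ≤ lev i, (n : ℝ) ^ 2 / 2 ^ (2 * lev i) ≤ 4 * (n : ℝ) ^ 2 / 2 ^ m := by
  have hzero : ∀ m, h < m →
      ∑ i with m ≤ lev i, (n : ℝ) ^ 2 / 2 ^ (2 * lev i) ≤ 4 * (n : ℝ) ^ 2 / 2 ^ m := by
    intro m hmh
    rw [Finset.filter_eq_empty_iff.2 fun i _ => by have := (hl.1 i).2; omega]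
    simp only [Finset.sum_empty]
    positivity
  suffices ∀ r m, 1 ≤ m → h < m + r →
      ∑ i with m ≤ lev i, (n : ℝ) ^ 2 / 2 ^ (2 * lev i) ≤ 4 * (n : ℝ) ^ 2 / 2 ^ m from
    this (h + 1) m hm (by omega)
  intro r
  induction r with
  | zero => exact fun m _ => hzero m
  | succ r ih =>
    intro m hm hr
    rcases lt_or_ge h m with hmh | hmh
    · exact hzero m hmh
    have h1 : (Finset.univ.filter fun i => m ≤ lev i) =
        (Finset.univ.filter fun i => m + 1 ≤ lev i) ∪ (Finset.univ.filter fun i => lev i = m) := by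
      ext i
      simp only [Finset.mem_filter, Finset.mem_univ, true_and, Finset.mem_union]
      omega
    have h2 : ∑ i with lev i = m, (n : ℝ) ^ 2 / 2 ^ (2 * lev i) =
        2 ^ (m + 1) * ((n : ℝ) ^ 2 / 2 ^ (2 * m)) := by
      rw [Finset.sum_congr rfl fun i hi => by rw [(Finset.mem_filter.1 hi).2],
        Finset.sum_const, hl.2 m hm hmh]
      simp
    rw [h1, Finset.sum_union, h2]
    · refine (add_le_add_left (ih (m + 1) (by omega) (by omega)) _).trans_eq ?_
      rw [pow_succ, two_mul m, pow_add]
      field_simp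
      ring
    · rw [Finset.disjoint_filter]
      intro i _ h
      omega

theorem sum_eq_sum_range_card {n : ℕ} {π : Equiv.Perm (Fin n)} {w : Fin n → ℝ}
    (hw : ∀ a b, a ≤ b → w (π b) ≤ w (π a)) {H : Finset (Fin n)}
    (hH : ∀ i ∈ H, ∀ i' ∉ H, w i' < w i) {x : ℕ → ℝ} (hx : ∀ b : Fin n, x b = w (π b)) :
    ∑ i ∈ H, w i = ∑ b ∈ Finset.range H.card, x b := by
  have h1 : H = Finset.univ.filter fun i => (π.symm i : ℕ) < H.card := by
    ext i
    have := mem_iff_lt_card hw hH (π.symm i)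
    rw [Equiv.apply_symm_apply] at this
    simp [this]
  have hle : H.card ≤ n := by simpa using Finset.card_le_univ H
  have h2 := sum_ite_perm_eq π w x hx hle (P := fun _ => True) (P' := fun _ => True)
    (fun _ => Iff.rfl)
  rw [Finset.filter_true, Finset.filter_true, ← h1] at h2
  exact h2

theorem sketchCost_nonneg {m n d : ℕ} (k : ℕ) (S : Matrix (Fin m) (Fin n) ℝ)
    (A : Matrix (Fin n) (Fin d) ℝ) : 0 ≤ sketchCost k S A := by
  refine Real.sInf_nonneg ?_
  rintro c ⟨X, -, -, rfl⟩
  exact Finset.sum_nonneg fun i _ => Finset.sum_nonneg fun j _ => sq_nonneg _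

theorem expectedRandomCost_nonneg {n d : ℕ} (k : ℕ) (τ : Fin n → ℝ)
    (A : Matrix (Fin n) (Fin d) ℝ) : 0 ≤ expectedRandomCost k τ A :=
  div_nonneg (Finset.sum_nonneg fun _ _ => sketchCost_nonneg _ _ _) (by positivity)

/-- `L` is the level of the `k`-th largest element: levels below `L` hold `2 ^ (L + 1) - 4 < k`
rows, and including `L` there are `2 ^ (L + 2) - 4 ≥ k`. -/
theorem exists_level (k : ℕ) (hk : 1 ≤ k) :
    ∃ L, 1 ≤ L ∧ 2 ^ (L + 1) < k + 4 ∧ k + 4 ≤ 2 ^ (L + 2) := by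
  have h1 := Nat.pow_log_le_self 2 (x := k + 3) (by omega)
  have h2 := Nat.lt_pow_succ_log_self (b := 2) (by norm_num) (k + 3)
  have h3 : 2 ≤ Nat.log 2 (k + 3) := Nat.le_log_of_pow_le (by norm_num) (by omega)
  refine ⟨Nat.log 2 (k + 3) - 1, by omega, ?_, ?_⟩
  · rw [Nat.sub_add_cancel (by omega)]
    omega
  · rw [show Nat.log 2 (k + 3) - 1 + 2 = (Nat.log 2 (k + 3)).succ by omega]
    omega

/-- The loss of the greedy algorithm on Zipfian weights, in terms of the levels that do not fit
into separate bins. -/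
theorem IsGreedySeq.zipf_loss_le {n k h L : ℕ} {lev : Fin n → ℕ} (hl : IsZipfLevels h lev)
    (hk : 0 < k) (hkn : k < n) (hL1 : 1 ≤ L) (hL2 : 2 ^ (L + 1) < k + 4)
    (hL3 : k + 4 ≤ 2 ^ (L + 2)) (hLh : L ≤ h) {π : Equiv.Perm (Fin n)} {w : Fin n → ℝ}
    (hw : ∀ i, w i = (n : ℝ) ^ 2 / 2 ^ (2 * lev i))
    (hanti : ∀ a b, a ≤ b → w (π b) ≤ w (π a)) {x : ℕ → ℝ} {q : ℕ → Fin k}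
    (hx : ∀ b : Fin n, x b = w (π b)) (hq : IsGreedySeq 0 n x q) :
    ∑ b ∈ Finset.range n, x b - captured x (Finset.range n) q ≤
      ∑ i with L ≤ lev i, w i - ((n : ℝ) ^ 2 / 2 ^ (2 * L)) *
        (k - (Finset.univ.filter fun i => lev i < L).card) + 2 * ((n : ℝ) ^ 2 / 2 ^ (2 * L)) := by
  set θ : ℝ := (n : ℝ) ^ 2 / 2 ^ (2 * L) with hθ
  have hn0 : (0 : ℝ) < n := by exact_mod_cast (by omega : 0 < n)
  have hθ0 : 0 < θ := by positivity
  have hwlt : ∀ i i', lev i < lev i' → 4 * w i' ≤ w i := by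
    intro i i' h
    rw [hw, hw, mul_div_assoc', div_le_div_iff₀ (by positivity) (by positivity)]
    have h1 : (2 : ℝ) ^ (2 * lev i + 2) ≤ 2 ^ (2 * lev i') :=
      pow_le_pow_right₀ (by norm_num) (by omega)
    calc 4 * (n : ℝ) ^ 2 * 2 ^ (2 * lev i) = n ^ 2 * 2 ^ (2 * lev i + 2) := by ring
      _ ≤ _ := by gcongr
  have hwpos : ∀ i, 0 < w i := fun i => by rw [hw]; positivity
  have hsep : ∀ m, ∀ i ∈ (Finset.univ.filter fun i => lev i < m),
      ∀ i' ∉ (Finset.univ.filter fun i => lev i < m), w i' < w i := by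
    intro m i hi i' hi'
    simp only [Finset.mem_filter, Finset.mem_univ, true_and] at hi hi'
    have := hwlt i i' (by omega)
    linarith [hwpos i']
  have hfirst : ∀ m (b : ℕ) (hb : b < n), lev (π ⟨b, hb⟩) < m ↔
      b < (Finset.univ.filter fun i => lev i < m).card := fun m b hb => by
    simpa using mem_iff_lt_card hanti (hsep m) ⟨b, hb⟩
  have hcL := hl.card_lt (m := L) hL1 (by omega)
  have hcL1 : (Finset.univ.filter fun i => lev i < L + 1).card + 4 = 2 ^ (L + 2) :=
    hl.card_lt (m := L + 1) (by omega) (by omega)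
  have hcn : ∀ m, (Finset.univ.filter fun i => lev i < m).card ≤ n := fun m => by
    simpa using Finset.card_le_univ (Finset.univ.filter fun i => lev i < m)
  have hsumL := sum_eq_sum_range_card hanti (hsep L) hx
  have hsumL2 := sum_eq_sum_range_card hanti (hsep (L + 2)) hx
  have hmono : (Finset.univ.filter fun i => lev i < L + 1).card ≤
      (Finset.univ.filter fun i => lev i < L + 2).card :=
    Finset.card_le_card (Finset.monotone_filter_right _ fun i _ (h : lev i < L + 1) =>
      (by omega : lev i < L + 2))
  have hcompl : ∀ m, (Finset.univ.filter fun i => lev i < m)ᶜ =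
      Finset.univ.filter fun i => m ≤ lev i := fun m => by
    ext i; simp
  set N₀ := (Finset.univ.filter fun i => lev i < L).card with hN₀
  set N := (Finset.univ.filter fun i => lev i < L + 1).card with hN
  set N' := (Finset.univ.filter fun i => lev i < L + 2).card with hN'
  have hxlevel : ∀ m b, b < n → (Finset.univ.filter fun i => lev i < m).card ≤ b →
      b < (Finset.univ.filter fun i => lev i < m + 1).card →
      x b = (n : ℝ) ^ 2 / 2 ^ (2 * m) := by
    intro m b hbn hb1 hb2
    have h1 := (hfirst (m + 1) b hbn).2 hb2
    have h2 := mt (hfirst m b hbn).1 (not_lt.2 hb1)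
    rw [hx ⟨b, hbn⟩, hw, show lev (π ⟨b, hbn⟩) = m by omega]
  have hxL : ∀ b, N₀ ≤ b → b < N → x b = θ := fun b h1 h2 =>
    hxlevel L b (h2.trans_le (hcn _)) h1 h2
  have hkey := hq.sum_sub_le_captured (N := N) (N' := N') (θ := θ) hk hθ0
    (fun b hb => by rw [hx ⟨b, hb⟩]; exact hwpos _)
    (fun a b hab hb => by
      rw [hx ⟨b, hb⟩, hx ⟨a, by omega⟩]
      exact hanti _ _ hab)
    (by omega)
    (fun b hb => by
      rcases lt_or_ge b N₀ with h | h
      · right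
        have hb' : b < n := by omega
        have h1 := (hfirst L b hb').2 h
        -- Element `N - 1` represents level `L`, so that the factor `4` between levels can be
        -- applied to `θ`.
        have hNL : N - 1 < n := by have := hcn (L + 1); omega
        have h2 : x (N - 1) = θ := hxL _ (by omega) (by omega)
        have h3 : lev (π ⟨N - 1, hNL⟩) = L := by
          have h4 := (hfirst (L + 1) (N - 1) hNL).2 (by omega)
          have h5 := mt (hfirst L (N - 1) hNL).1 (by omega)
          omega
        rw [← h2, hx ⟨N - 1, hNL⟩, hx ⟨b, hb'⟩]
        exact hwlt _ _ (by omega)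
      · exact Or.inl (hxL b h (by omega)))
    (fun b hb1 hb2 => hxL b (by omega) hb2)
    hmono (hcn _)
    (fun b hb1 hb2 => by
      rw [hxlevel (L + 1) b (hb2.trans_le (hcn _)) hb1 hb2, hθ, mul_add, pow_add]
      field_simp
      norm_num)
    (by
      have h1 : ∑ b ∈ Finset.Ico N' n, x b = ∑ i with L + 2 ≤ lev i, w i := by
        rw [← hcompl, Finset.sum_Ico_eq_sub _ (hcn _), ← hsumL2, ← sum_perm_eq π w x hx,
          ← Finset.sum_add_sum_compl (Finset.univ.filter fun i => lev i < L + 2)]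
        ring
      rw [h1]
      rcases hLh.eq_or_lt with rfl | hlt
      · rw [Finset.filter_eq_empty_iff.2 fun i _ => by have := (hl.1 i).2; omega]
        have : (N : ℝ) ≤ N' := by exact_mod_cast hmono
        simp only [Finset.sum_empty]
        apply mul_nonneg <;> linarith
      · have hcL2 := hl.card_lt (m := L + 2) (by omega) (by omega)
        rw [← hN'] at hcL2
        have e1 : (N : ℝ) + 4 = 2 ^ (L + 2) := by exact_mod_cast hcL1
        have e2 : (N' : ℝ) + 4 = 2 ^ (L + 3) := by exact_mod_cast hcL2
        -- The tail bound for levels from `L + 2` on equals the total weight `n² / 2 ^ L` of level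
        -- `L + 1`.
        have e3 : (N' : ℝ) - N = 2 ^ (L + 2) := by
          rw [pow_succ 2 (L + 2)] at e2
          linarith
        simp_rw [hw]
        refine (hl.sum_le (m := L + 2) (by omega)).trans_eq ?_
        rw [e3, hθ, two_mul, pow_add, pow_add]
        field_simp
        norm_num)
  have hsumk : ∑ b ∈ Finset.range k, x b =
      ∑ i with lev i < L, w i + θ * (k - N₀) := by
    have hle : N₀ ≤ k := by omega
    rw [← Finset.sum_range_add_sum_Ico _ hle, hsumL, Finset.sum_congr rfl
      (fun b hb => hxL b (Finset.mem_Ico.1 hb).1 (by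
        have := (Finset.mem_Ico.1 hb).2; omega))]
    rw [Finset.sum_const, Nat.card_Ico, nsmul_eq_mul, Nat.cast_sub hle]
    ring
  have htot : ∑ b ∈ Finset.range n, x b = ∑ i with lev i < L, w i + ∑ i with L ≤ lev i, w i := by
    rw [← sum_perm_eq π w x hx, ← hcompl, Finset.sum_add_sum_compl]
  linarith

theorem greedyBeatsRandom_of_zipf {n d k h N : ℕ} (hk : 64 ≤ k) {lev : Fin n → ℕ}
    {A : Fin N → Matrix (Fin n) (Fin d) ℝ} (hl : IsZipfLevels h lev)
    (hA : ∀ t, IsZipfMatrix lev (A t)) : GreedyBeatsRandom k (1 / 20) A := by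
  intro T π σ p hT hσ hp t τ τ' hτ hτ'
  set w : Fin n → ℝ := fun i => (n : ℝ) ^ 2 / 2 ^ (2 * lev i) with hw
  have hwpos : ∀ i, 0 < w i := fun i => by
    have : (0 : ℝ) < n := by exact_mod_cast (by have := i.2; omega : 0 < n)
    positivity
  have hanti : ∀ a b, a ≤ b → w (π b) ≤ w (π a) := fun a b hab => by
    obtain ⟨t₀, ht₀⟩ := hT
    have := hp.1 t₀ ht₀ a b hab
    rwa [(hA t₀).2, (hA t₀).2] at this
  have : Nonempty (Fin k) := ⟨⟨0, by omega⟩⟩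
  obtain ⟨x, hx⟩ := exists_nat_extension fun b => w (π b)
  obtain ⟨q, hq⟩ := exists_nat_extension fun b => p (π b)
  have hseq := isGreedySeq_of_isGreedyRun zero_le_one hwpos hT
    (fun t _ => (hA t).nearOrthogonal) hσ hp x q hx hq
  have hup := (sketchCost_sign_bounds zero_le_one hwpos (hA t).nearOrthogonal p hτ).2
  rw [add_zero, one_mul, diagCost_univ_eq π w p x q hx hq] at hup
  have hxpos : ∀ b < n, 0 < x b := fun b hb => by rw [hx ⟨b, hb⟩]; exact hwpos _
  have hxanti : ∀ a b, a ≤ b → b < n → x b ≤ x a := fun a b hab hb => by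
    rw [hx ⟨b, hb⟩, hx ⟨a, by omega⟩]
    exact hanti _ _ hab
  -- With at least as many bins as rows, greedy has no loss at all.
  rcases le_or_gt n k with hnk | hkn
  · have h1 := sum_le_captured (q := q) (fun i hi => (hxpos i (Finset.mem_range.1 hi)).le)
      (subset_refl (Finset.range n)) (fun b hb b' hb' =>
        hseq.ne_of_le hxpos hxanti n le_rfl hnk b (Finset.mem_range.1 hb) b'
          (Finset.mem_range.1 hb'))
    have h2 := expectedRandomCost_nonneg k τ' (A t)
    linarith
  obtain ⟨L, hL1, hL2, hL3⟩ := exists_level k (by omega)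
  have hnh : n + 4 = 2 ^ (h + 2) := by
    have := hl.card_lt (m := h + 1) (by omega) le_rfl
    rwa [Finset.filter_true_of_mem fun i _ => Nat.lt_succ_of_le (hl.1 i).2, Finset.card_univ,
      Fintype.card_fin] at this
  have hLh : L ≤ h := by
    have : 2 ^ (L + 1) < 2 ^ (h + 2) := by omega
    have := (Nat.pow_lt_pow_iff_right (by norm_num)).1 this
    omega
  have hgreedy := hup.trans
    (hseq.zipf_loss_le hl (by omega) hkn hL1 hL2 hL3 hLh (fun _ => rfl) hanti hx)
  have hn0 : (0 : ℝ) < n := by exact_mod_cast (by omega : 0 < n)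
  have hcL := hl.card_lt (m := L) hL1 (by omega)
  have htail := hl.sum_le hL1
  set H := Finset.univ.filter fun i => lev i < L with hH
  set θ : ℝ := (n : ℝ) ^ 2 / 2 ^ (2 * L) with hθ
  have hθ0 : 0 < θ := by positivity
  have hcompl : Hᶜ = Finset.univ.filter fun i => L ≤ lev i := by
    ext i; simp [hH]
  have hwH : ∀ i ∈ H, 4 * θ ≤ w i := by
    intro i hi
    have hi' : lev i < L := (Finset.mem_filter.1 hi).2
    rw [hθ, mul_div_assoc', div_le_div_iff₀ (by positivity) (by positivity)]
    have h1 : (2 : ℝ) ^ (2 * lev i + 2) ≤ 2 ^ (2 * L) :=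
      pow_le_pow_right₀ (by norm_num) (by omega)
    calc 4 * (n : ℝ) ^ 2 * 2 ^ (2 * lev i) = n ^ 2 * 2 ^ (2 * lev i + 2) := by ring
      _ ≤ _ := by gcongr
  have hwH' : ∀ i ∉ H, w i ≤ θ := by
    intro i hi
    have hi' : L ≤ lev i := by simpa [hH] using hi
    apply div_le_div_of_nonneg_left (by positivity) (by positivity)
    exact pow_le_pow_right₀ (by norm_num) (by omega)
  have hlow := le_expectedRandomCost (n := n) (d := d) (k := k) (by omega) τ' (A t) H (by omega)
    (a := ∑ i with L ≤ lev i, w i - θ * (k - H.card)) (b := 3 * θ) (by positivity) fun p' => by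
      have h1 := (sketchCost_sign_bounds zero_le_one hwpos (hA t).nearOrthogonal p' hτ').1
      rw [sub_zero, one_mul] at h1
      refine le_trans (le_of_eq_of_le ?_ (le_diagCost_of_le hθ0.le (by linarith : θ ≤ 4 * θ)
        (fun i => (hwpos i).le) hwH hwH' p')) h1
      rw [hcompl]
      ring
  have hM : (H.card : ℝ) + 4 = 2 ^ (L + 1) := by exact_mod_cast hcL
  have hM2 : (k : ℝ) ≤ 2 * H.card + 4 := by
    have : k ≤ 2 * H.card + 4 := by rw [pow_succ] at hL3; omega
    exact_mod_cast this
  have hM3 : (H.card : ℝ) ≤ k := by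
    have : H.card ≤ k := by omega
    exact_mod_cast this
  have hk' : (64 : ℝ) ≤ k := by exact_mod_cast hk
  have htail' : ∑ i with L ≤ lev i, w i ≤ 2 * (H.card + 4) * θ := by
    refine htail.trans_eq ?_
    rw [hM, hθ, two_mul L, pow_add]
    field_simp
    ring
  have hX : ((H.card : ℝ) / 2 - 2) * θ ≤
      3 * θ * (H.card * (H.card - 1) / (3 * k)) := by
    have h1 : (H.card : ℝ) / 2 - 2 ≤ H.card * (H.card - 1) / k := by
      rw [le_div_iff₀ (by linarith)]
      nlinarith
    have h2 := mul_le_mul_of_nonneg_right h1 hθ0.le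
    refine h2.trans_eq ?_
    field_simp
  have h3 : 0 ≤ θ * (k - H.card) := mul_nonneg hθ0.le (by linarith)
  have h4 : 30 * θ ≤ H.card * θ := by
    apply mul_le_mul_of_nonneg_right _ hθ0.le
    linarith
  -- Greedy loses at most `a + 2 θ`, and random positions at least `a + (H.card / 2 - 2) θ`, with `a
  -- ≤ 2 (H.card + 4) θ`. Since `k ≥ 64` gives `H.card ≥ 30`, the additive constants are harmless.
  nlinarith

theorem mainTheorem3 :
    ∃ η : ℝ, 0 < η ∧ η < 1 ∧
      -- spiked covariance model
      (∀ c : ℕ, ∃ C : ℝ, 0 < C ∧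
        ∀ (n d k s N : ℕ) (α ℓ : ℝ) (R : Finset (Fin n)),
          R.card = s → 1 ≤ s → (s : ℝ) = α * ((k : ℝ) - 1) → 7 / 10 < α → α < 1 →
          1 < ℓ → (4 * Real.exp 1 + 1) * n / (α * k) ≤ ℓ ^ 2 →
          C * (n : ℝ) ^ 6 * ℓ ^ 2 ≤ d →
          spikedDirections N n d
              {V | ¬ GreedyBeatsRandom k η (fun t => spikedMatrix R ℓ (V t))} ≤
            ENNReal.ofReal ((N : ℝ) / (n : ℝ) ^ c)) ∧
      -- Zipfian squared row norms
      (∃ k₀ : ℕ, ∀ k : ℕ, k₀ ≤ k →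
        ∀ (n d h N : ℕ) (lev : Fin n → ℕ) (A : Fin N → Matrix (Fin n) (Fin d) ℝ),
          IsZipfLevels h lev → (∀ t, IsZipfMatrix lev (A t)) →
          GreedyBeatsRandom k η A) := by
  refine ⟨1 / 20, by norm_num, by norm_num, fun c =>
    ⟨512 * (2 * ((c + 2).factorial : ℝ)), by positivity, ?_⟩, 64, ?_⟩
  · intro n d k s N α ℓ R hR hs hsα hα hα1 hℓ hℓn hd
    exact spikedDirections_not_greedyBeatsRandom_le c hR hs hsα hα hα1 hℓ hℓn hd
  · intro k hk n d h N lev A hl hA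
    exact greedyBeatsRandom_of_zipf hk hl hA

end
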